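/- Let $c_0$ be the complex Banach space of null sequences with the supremum norm and canonical vectors $(e_k)_{k\ge 1}$, and for a continuous bilinear form $A\colon c_0\times c_0\to\mathbb C$ let $\|A\|=\sup\{|A(x,y)| : \|x\|_\infty\le 1,\ \|y\|_\infty\le 1\}$. For $a,b\in[1,\infty]$ let $C^{\mathbb C}_{a,b}$ be the infimum of all real $C$ such that $$\Biggl(\sum_{i=1}^\infty\biggl(\sum_{j=1}^\infty |A(e_i,e_j)|^a\biggr)^{b/a}\Biggr)^{1/b}\le C\,\|A\|$$ for every continuous bilinear form $A\colon c_0\times c_0\to\mathbb C$, where $1/\infty=0$ and, for an infinite exponent $p$, $\bigl(\sum_k|x_k|^{p}\bigr)^{1/p}$ means $\sup_k|x_k|$ (for the inner sum with $p=a$, for the outer one with $p=b$). (i) If $a,b\in[1,\infty]$ and $\frac1a+\frac1b\le\frac32$, then $1\le C^{\mathbb C}_{a,b}<\infty$, and the inequality holds with $C=C^{\mathbb C}_{a,b}$ for every $A$; that is, $C^{\mathbb C}_{a,b}$ is the least (optimal) constant. (ii) If moreover $b\le a$, then $$1\le C^{\mathbb C}_{b,a}\le C^{\mathbb C}_{a,b}\le\Bigl(\frac4\pi\Bigr)^{\max\{0,\,\frac1a+\frac1b-1\}}.$$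 (iii) If $a,b\in[1,\infty]$ and $\frac1a+\frac1b\le 1$, then $C^{\mathbb C}_{a,b}=1$. -/

import Mathlib

open scoped NNReal ENNReal

noncomputable section

/-- The complex Banach space `c₀` of null sequences with the supremum norm, realised as the space
of (continuous) functions on the discrete space `ℕ` that vanish at infinity. -/
def NullSeq : Type := ZeroAtInftyContinuousMap ℕ ℂ

instance : FunLike NullSeq ℕ ℂ :=
  inferInstanceAs (FunLike (ZeroAtInftyContinuousMap ℕ ℂ) ℕ ℂ)

instance : NormedAddCommGroup NullSeq :=
  inferInstanceAs (NormedAddCommGroup (ZeroAtInftyContinuousMap ℕ ℂ))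

instance : NormedSpace ℂ NullSeq :=
  inferInstanceAs (NormedSpace ℂ (ZeroAtInftyContinuousMap ℕ ℂ))

/-- The canonical vector `e k` of `c₀`: it is `1` at the index `k` and `0` elsewhere. -/
def NullSeq.e (k : ℕ) : NullSeq :=
  ({ toFun := Pi.single k 1
     continuous_toFun := continuous_of_discreteTopology
     zero_at_infty' := by
      rw [Filter.cocompact_eq_cofinite]
      refine tendsto_const_nhds.congr' ?_
      filter_upwards [(Set.finite_singleton k).compl_mem_cofinite] with i hi
      exact (Pi.single_eq_of_ne (M := fun _ : ℕ => ℂ) hi 1).symm } :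
    ZeroAtInftyContinuousMap ℕ ℂ)

/-- Continuous complex bilinear forms `A : c₀ × c₀ → ℂ`, in curried form. The norm `‖A‖` is the
usual one, the supremum of `|A x y|` over `x`, `y` in the closed unit ball of `c₀`. -/
abbrev NullSeqBilinForm : Type := NullSeq →L[ℂ] NullSeq →L[ℂ] ℂ

/-- The quantity `(∑ i, x i ^ p) ^ (1 / p)` in `[0, ∞]` for a sequence in `[0, ∞]`,
read as `sup i, x i` when `p = ∞`. It is used for `1 ≤ p` only. -/
def powerSum (p : ℝ≥0∞) (x : ℕ → ℝ≥0∞) : ℝ≥0∞ :=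
  if p = ∞ then ⨆ i, x i else (∑' i, x i ^ p.toReal) ^ (1 / p.toReal)

/-- The mixed sum `(∑ i, (∑ j, |A (e i) (e j)| ^ a) ^ (b / a)) ^ (1 / b)`, with value in `[0, ∞]`:
the inner sum, over the second variable, has exponent `a`; the outer one has exponent `b`. -/
def mixedSum (a b : ℝ≥0∞) (A : NullSeqBilinForm) : ℝ≥0∞ :=
  powerSum b fun i => powerSum a fun j => ‖A (NullSeq.e i) (NullSeq.e j)‖ₑ

/-- `C` is a constant for the complex anisotropic Littlewood inequality with exponents `(a, b)`:
the mixed sum of every continuous bilinear form `A` is finite and at most `C * ‖A‖`. -/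
def IsLittlewoodConstant (a b : ℝ≥0∞) (C : ℝ) : Prop :=
  ∀ A : NullSeqBilinForm, mixedSum a b A ≤ ENNReal.ofReal (C * ‖A‖)

/-- The optimal constant for the exponents `(a, b)`: the infimum of all constants. -/
def optimalConstant (a b : ℝ≥0∞) : ℝ :=
  sInf {C : ℝ | IsLittlewoodConstant a b C}

end

open MeasureTheory

/-! Write u = 1/a and v = 1/b. The mixed norm of a fixed matrix is log-convex in (u, v), so a bound
(4/π)^c ‖A‖ interpolates linearly in (u, v, c). It is enough to treat a few extreme points with u ≤
v: (0,0), (0,1), (1/2,1/2) with c = 0, and (1/2,1), (1,1/2) with c = 1/2. The hull of these points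
contains every admissible point with b ≤ a, and c = max(0, u + v - 1) results. The case a ≤ b
follows by transposing A and applying Minkowski's inequality.

At the extreme points, put random phases in the second variable. If S_i is the Steinhaus sum with
the coefficients of row i, duality gives ∑ |S_i| ≤ ‖A‖ pointwise. The point (0,1) uses that E|S_i|
dominates each coefficient of the row, the point (1/2,1/2) uses orthogonality, and (1/2,1) uses
Khinchine's inequality in L¹ with its best constant (4/π)^(1/2), which is
`sqrt_sum_sq_le_integral_norm_steinhausSum`. Transposition gives (1,1/2).

Most of the work is that Khinchine inequality: E|S| ≥ √π/2 when ∑ |a_j|² = 1. If some |a_j|² ≥ 1/2,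
average over that phase alone and bound the result below by a quartic polynomial in the modulus of
the rest, whose second and fourth moments are controlled (`le_integral_norm_steinhausSum_of_large`).
Otherwise use E|S| = ∫ (1 - ∏ J₀(t|a_j|)) / t² dt over t > 0. Weighted AM-GM separates the factors,
and it remains to show ∫ (exp(-su²/4) - |J₀(u)|^s) / u² du ≥ 0 for s = 1/|a_j|² ≥ 2
(`integral_besselGap_nonneg`). A pointwise comparison reduces this to s = 2, where ∫ (1 - J₀²)/u² =
4/π is known exactly.

The lower bound 1 comes from the form x₀y₀, and the infimum is attained because the admissible
constants form a closed set. -/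

/-! ### Mixed norms in reciprocal exponents: Hölder and Minkowski. -/

/-- The `ℓ^{1/u}` norm of a sequence in `[0, ∞]`, the supremum for `u = 0`. -/
noncomputable def recipNorm (u : ℝ) (x : ℕ → ℝ≥0∞) : ℝ≥0∞ :=
  if u = 0 then ⨆ i, x i else (∑' i, x i ^ u⁻¹) ^ u

theorem recipNorm_zero (x : ℕ → ℝ≥0∞) : recipNorm 0 x = ⨆ i, x i := by simp [recipNorm]

theorem recipNorm_of_ne {u : ℝ} (hu : u ≠ 0) (x : ℕ → ℝ≥0∞) :
    recipNorm u x = (∑' i, x i ^ u⁻¹) ^ u := by simp [recipNorm, hu]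

theorem powerSum_eq_recipNorm {p : ℝ≥0∞} (hp : p ≠ 0) (x : ℕ → ℝ≥0∞) :
    powerSum p x = recipNorm (p⁻¹).toReal x := by
  unfold powerSum recipNorm
  by_cases h : p = ∞
  · simp [h]
  · have : (p⁻¹).toReal ≠ 0 := by
      simp [ENNReal.toReal_eq_zero_iff, h, hp]
    rw [if_neg h, if_neg this]
    simp [ENNReal.toReal_inv]

theorem recipNorm_mono {u : ℝ} (hu : 0 ≤ u) {x y : ℕ → ℝ≥0∞} (h : ∀ i, x i ≤ y i) :
    recipNorm u x ≤ recipNorm u y := by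
  rcases hu.eq_or_lt with rfl | hu
  · simpa [recipNorm_zero] using iSup_mono h
  · rw [recipNorm_of_ne hu.ne', recipNorm_of_ne hu.ne']
    gcongr with i
    exact h i

/-- Log-convexity of `u ↦ ‖x‖_{1/u}`, in its two-sequence form (Hölder's inequality). -/
theorem recipNorm_rpow_mul_rpow_le {u v s t : ℝ} (hu : 0 ≤ u) (hv : 0 ≤ v) (hs : 0 < s)
    (ht : 0 < t) (x y : ℕ → ℝ≥0∞) :
    recipNorm (s * u + t * v) (fun i => x i ^ s * y i ^ t) ≤
      recipNorm u x ^ s * recipNorm v y ^ t := by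
  -- A zero reciprocal means a supremum, which is simply pulled out of the sum. Hölder's inequality,
  -- with weights s u / w and t v / w, is needed only when both reciprocals are positive.
  rcases hu.eq_or_lt with rfl | hu <;> rcases hv.eq_or_lt with rfl | hv
  · simp only [mul_zero, add_zero, recipNorm_zero]
    refine iSup_le fun i => ?_
    gcongr
    · exact le_iSup x i
    · exact le_iSup y i
  · have h0 : t * v ≠ 0 := (mul_pos ht hv).ne'
    rw [mul_zero, zero_add, recipNorm_zero, recipNorm_of_ne h0, recipNorm_of_ne hv.ne']
    calc (∑' i, (x i ^ s * y i ^ t) ^ (t * v)⁻¹) ^ (t * v)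
        ≤ (∑' i, ((⨆ i, x i) ^ s) ^ (t * v)⁻¹ * y i ^ v⁻¹) ^ (t * v) := by
          gcongr with i
          rw [ENNReal.mul_rpow_of_nonneg _ _ (by positivity), ← ENNReal.rpow_mul (y i)]
          have : t * (t * v)⁻¹ = v⁻¹ := by field_simp
          rw [this]
          gcongr
          exact le_iSup x i
      _ = _ := by
          rw [ENNReal.tsum_mul_left, ENNReal.mul_rpow_of_nonneg _ _ (by positivity),
            ← ENNReal.rpow_mul, inv_mul_cancel₀ h0, ENNReal.rpow_one, ← ENNReal.rpow_mul, mul_comm t]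
  · have h0 : s * u ≠ 0 := (mul_pos hs hu).ne'
    rw [mul_zero, add_zero, recipNorm_zero, recipNorm_of_ne h0, recipNorm_of_ne hu.ne']
    calc (∑' i, (x i ^ s * y i ^ t) ^ (s * u)⁻¹) ^ (s * u)
        ≤ (∑' i, x i ^ u⁻¹ * ((⨆ i, y i) ^ t) ^ (s * u)⁻¹) ^ (s * u) := by
          gcongr with i
          rw [ENNReal.mul_rpow_of_nonneg _ _ (by positivity), ← ENNReal.rpow_mul (x i)]
          have : s * (s * u)⁻¹ = u⁻¹ := by field_simp
          rw [this]
          gcongr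
          exact le_iSup y i
      _ = _ := by
          rw [ENNReal.tsum_mul_right, ENNReal.mul_rpow_of_nonneg _ _ (by positivity),
            ← ENNReal.rpow_mul _ (s * u)⁻¹, inv_mul_cancel₀ h0, ENNReal.rpow_one,
            ← ENNReal.rpow_mul, mul_comm s]
  · have hw : 0 < s * u + t * v := by positivity
    set w := s * u + t * v with hwdef
    rw [recipNorm_of_ne hw.ne', recipNorm_of_ne hu.ne', recipNorm_of_ne hv.ne']
    have key := ENNReal.lintegral_mul_norm_pow_le (μ := MeasureTheory.Measure.count)
      (f := fun i => x i ^ u⁻¹) (g := fun i => y i ^ v⁻¹) (measurable_from_nat.aemeasurable)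
      (measurable_from_nat.aemeasurable) (p := s * u / w) (q := t * v / w) (by positivity)
      (by positivity) (by rw [← add_div, ← hwdef, div_self hw.ne'])
    simp only [MeasureTheory.lintegral_count] at key
    calc (∑' i, (x i ^ s * y i ^ t) ^ w⁻¹) ^ w
        = (∑' i, (x i ^ u⁻¹) ^ (s * u / w) * (y i ^ v⁻¹) ^ (t * v / w)) ^ w := by
          congr 2 with i
          rw [ENNReal.mul_rpow_of_nonneg _ _ (by positivity), ← ENNReal.rpow_mul,
            ← ENNReal.rpow_mul, ← ENNReal.rpow_mul, ← ENNReal.rpow_mul]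
          congr 2 <;> field_simp
      _ ≤ _ := by
          refine (ENNReal.rpow_le_rpow key hw.le).trans_eq ?_
          rw [ENNReal.mul_rpow_of_nonneg _ _ hw.le, ← ENNReal.rpow_mul, ← ENNReal.rpow_mul,
            ← ENNReal.rpow_mul, ← ENNReal.rpow_mul, div_mul_cancel₀ _ hw.ne',
            div_mul_cancel₀ _ hw.ne', mul_comm s, mul_comm t]

/-- The mixed norm with inner exponent `1 / u` and outer exponent `1 / v`. -/
noncomputable def mixedNorm (u v : ℝ) (x : ℕ → ℕ → ℝ≥0∞) : ℝ≥0∞ :=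
  recipNorm v fun i => recipNorm u (x i)

/-- Log-convexity of the mixed norm in the reciprocals of its exponents. -/
theorem mixedNorm_convex {u v u' v' s t : ℝ} (hu : 0 ≤ u) (hv : 0 ≤ v) (hu' : 0 ≤ u')
    (hv' : 0 ≤ v') (hs : 0 < s) (ht : 0 < t) (hst : s + t = 1) (x : ℕ → ℕ → ℝ≥0∞) :
    mixedNorm (s * u + t * u') (s * v + t * v') x ≤
      mixedNorm u v x ^ s * mixedNorm u' v' x ^ t := by
  refine le_trans (recipNorm_mono (by positivity) fun i => ?_)
    (recipNorm_rpow_mul_rpow_le hv hv' hs ht _ _)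
  refine le_trans (le_of_eq ?_) (recipNorm_rpow_mul_rpow_le hu hu' hs ht (x i) (x i))
  congr 1 with j
  rw [← ENNReal.rpow_add_of_nonneg _ _ hs.le ht.le, hst, ENNReal.rpow_one]

theorem tsum_rpow_sum_le {r : ℝ} (hr : 1 ≤ r) (y : ℕ → ℕ → ℝ≥0∞) (s : Finset ℕ) :
    (∑' i, (∑ j ∈ s, y i j) ^ r) ^ r⁻¹ ≤ ∑ j ∈ s, (∑' i, y i j ^ r) ^ r⁻¹ := by
  induction s using Finset.induction_on with
  | empty => 
    have : 0 < r := by linarith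
    simp [this]
  | insert a s ha ih =>
    simp only [Finset.sum_insert ha]
    have := ENNReal.lintegral_Lp_add_le (μ := MeasureTheory.Measure.count)
      (f := fun i => y i a) (g := fun i => ∑ j ∈ s, y i j) measurable_from_nat.aemeasurable
      measurable_from_nat.aemeasurable hr
    simp only [MeasureTheory.lintegral_count, Pi.add_apply, one_div] at this
    exact this.trans (by gcongr)

/-- Minkowski's inequality for a double sequence. -/
theorem tsum_rpow_tsum_le {r : ℝ} (hr : 1 ≤ r) (y : ℕ → ℕ → ℝ≥0∞) :
    (∑' i, (∑' j, y i j) ^ r) ^ r⁻¹ ≤ ∑' j, (∑' i, y i j ^ r) ^ r⁻¹ := by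
  have hr0 : 0 < r := by linarith
  rw [ENNReal.rpow_inv_le_iff hr0, ENNReal.tsum_eq_iSup_sum]
  refine iSup_le fun t => ?_
  have hlim : Filter.Tendsto (fun s : Finset ℕ => ∑ i ∈ t, (∑ j ∈ s, y i j) ^ r) Filter.atTop
      (nhds (∑ i ∈ t, (∑' j, y i j) ^ r)) :=
    tendsto_finsetSum _ fun i _ =>
      (ENNReal.continuous_rpow_const.tendsto _).comp ENNReal.summable.hasSum
  refine le_of_tendsto' hlim fun s => ?_
  rw [← ENNReal.rpow_inv_le_iff hr0]
  calc (∑ i ∈ t, (∑ j ∈ s, y i j) ^ r) ^ r⁻¹ ≤ (∑' i, (∑ j ∈ s, y i j) ^ r) ^ r⁻¹ := by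
        gcongr
        exact ENNReal.sum_le_tsum t
    _ ≤ _ := (tsum_rpow_sum_le hr y s).trans (ENNReal.sum_le_tsum s)

/-- Minkowski's inequality for mixed norms: exchanging the order of summation. -/
theorem mixedNorm_swap_le {u v : ℝ} (hu : 0 ≤ u) (huv : u ≤ v) (x : ℕ → ℕ → ℝ≥0∞) :
    mixedNorm v u x ≤ mixedNorm u v fun i j => x j i := by
  unfold mixedNorm
  rcases hu.eq_or_lt with rfl | hu
  · simp only [recipNorm_zero]
    exact iSup_le fun i => recipNorm_mono huv fun j => le_iSup (fun i => x i j) i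
  · have hv : 0 < v := hu.trans_le huv
    simp only [recipNorm_of_ne hu.ne', recipNorm_of_ne hv.ne']
    have hr : 1 ≤ v / u := (one_le_div hu).2 huv
    -- Minkowski in ℓ^{v/u} for the powers x^(1/v); `e1` to `e4` only reconcile exponents.
    have key := tsum_rpow_tsum_le hr fun i j => x i j ^ v⁻¹
    have e1 : ∀ z : ℝ≥0∞, (z ^ v⁻¹) ^ (v / u) = z ^ u⁻¹ := fun z => by
      rw [← ENNReal.rpow_mul]; congr 1; field_simp
    have e2 : ∀ z : ℝ≥0∞, (z ^ v) ^ u⁻¹ = z ^ (v / u) := fun z => by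
      rw [← ENNReal.rpow_mul]; rfl
    have e3 : ∀ z : ℝ≥0∞, (z ^ u) ^ v⁻¹ = z ^ (v / u)⁻¹ := fun z => by
      rw [← ENNReal.rpow_mul]; congr 1; field_simp
    have e4 : ∀ z : ℝ≥0∞, (z ^ (v / u)⁻¹) ^ v = z ^ u := fun z => by
      rw [← ENNReal.rpow_mul]; congr 1; field_simp
    simp only [e1] at key
    simp only [e2, e3]
    rw [← e4]
    gcongr

/-! ### Independent uniform angles, Steinhaus sums and their moments. -/

/-- The uniform probability measure on `(0, 2π]`. -/
noncomputable def angleMeasure : Measure ℝ :=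
  (ENNReal.ofReal (2 * Real.pi))⁻¹ • volume.restrict (Set.Ioc 0 (2 * Real.pi))

instance : IsProbabilityMeasure angleMeasure := by
  constructor
  have h : ENNReal.ofReal (2 * Real.pi) ≠ 0 := by
    simpa using Real.pi_pos
  simp only [angleMeasure, Measure.smul_apply, Measure.restrict_apply_univ, Real.volume_Ioc,
    sub_zero, smul_eq_mul]
  exact ENNReal.inv_mul_cancel h ENNReal.ofReal_ne_top

theorem integral_angleMeasure {E : Type*} [NormedAddCommGroup E] [NormedSpace ℝ E] (f : ℝ → E) :
    ∫ θ, f θ ∂angleMeasure = (2 * Real.pi)⁻¹ • ∫ θ in (0 : ℝ)..2 * Real.pi, f θ := by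
  rw [angleMeasure, integral_smul_measure, intervalIntegral.integral_of_le (by positivity),
    ENNReal.toReal_inv, ENNReal.toReal_ofReal (by positivity)]

theorem integrable_angleMeasure {E : Type*} [NormedAddCommGroup E] [NormedSpace ℝ E]
    {f : ℝ → E} (hf : Continuous f) : Integrable f angleMeasure := by
  refine Integrable.smul_measure ?_ (by simpa using Real.pi_pos)
  exact (hf.integrableOn_Icc (a := 0) (b := 2 * Real.pi)).mono_set Set.Ioc_subset_Icc_self

theorem integral_angleMeasure_exp_pow {k : ℕ} (hk : k ≠ 0) :
    ∫ θ : ℝ, Complex.exp (θ * Complex.I) ^ k ∂angleMeasure = 0 := by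
  rw [integral_angleMeasure]
  have hk' : (k : ℂ) * Complex.I ≠ 0 := mul_ne_zero (by exact_mod_cast hk) Complex.I_ne_zero
  have h := integral_exp_mul_complex (a := 0) (b := 2 * Real.pi) hk'
  have h2 : Complex.exp ((k : ℂ) * Complex.I * ((2 * Real.pi : ℝ) : ℂ)) = 1 := by
    rw [← Complex.exp_nat_mul_two_pi_mul_I k]
    push_cast
    ring_nf
  rw [h2] at h
  have : ∫ θ in (0 : ℝ)..2 * Real.pi, Complex.exp (θ * Complex.I) ^ k = 0 := by
    simp only [← Complex.exp_nat_mul]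
    simpa [mul_comm, mul_left_comm, mul_assoc] using h
  rw [this, smul_zero]

theorem integral_angleMeasure_re_mul_exp_pow {k : ℕ} (hk : k ≠ 0) (c : ℂ) :
    ∫ θ : ℝ, (c * Complex.exp (θ * Complex.I) ^ k).re ∂angleMeasure = 0 := by
  have h := integral_re (𝕜 := ℂ) (integrable_angleMeasure
    (f := fun θ : ℝ => c * Complex.exp (θ * Complex.I) ^ k) (by fun_prop))
  simp only [RCLike.re_to_complex] at h
  rw [h, integral_const_mul, integral_angleMeasure_exp_pow hk]
  simp

/-- Averages over the angle are invariant under rotation. -/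
theorem integral_angleMeasure_add {E : Type*} [NormedAddCommGroup E] [NormedSpace ℝ E] {f : ℝ → E}
    (hf : Function.Periodic f (2 * Real.pi)) (φ : ℝ) :
    ∫ θ, f (θ + φ) ∂angleMeasure = ∫ θ, f θ ∂angleMeasure := by
  rw [integral_angleMeasure, integral_angleMeasure, intervalIntegral.integral_comp_add_right]
  congr 1
  rw [zero_add, add_comm (2 * Real.pi)]
  simpa using hf.intervalIntegral_add_eq φ 0

/-- The joint law of `n` independent uniform angles. -/
noncomputable abbrev angles (n : ℕ) : Measure (Fin n → ℝ) :=
  Measure.pi fun _ => angleMeasure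

/-- The Steinhaus sum `∑ j, a j * exp (i θ j)`. -/
noncomputable def steinhausSum {n : ℕ} (a : Fin n → ℂ) (θ : Fin n → ℝ) : ℂ :=
  ∑ j, a j * Complex.exp (θ j * Complex.I)

theorem continuous_steinhausSum {n : ℕ} (a : Fin n → ℂ) : Continuous (steinhausSum a) := by
  unfold steinhausSum
  fun_prop

theorem norm_steinhausSum_le {n : ℕ} (a : Fin n → ℂ) (θ : Fin n → ℝ) :
    ‖steinhausSum a θ‖ ≤ ∑ j, ‖a j‖ :=
  (norm_sum_le _ _).trans_eq (by simp [Complex.norm_exp_ofReal_mul_I])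

theorem integrable_comp_steinhausSum {n : ℕ} (a : Fin n → ℂ) {E : Type*} [NormedAddCommGroup E]
    [NormedSpace ℝ E] {g : ℂ → E} (hg : Continuous g) :
    Integrable (fun θ => g (steinhausSum a θ)) (angles n) := by
  obtain ⟨C, hC⟩ := (isCompact_closedBall (0 : ℂ) (∑ j, ‖a j‖)).exists_bound_of_continuousOn
    hg.continuousOn
  refine Integrable.of_bound (C := C) ?_ (ae_of_all _ fun θ => hC _ ?_)
  · have hmeas : Measurable (steinhausSum a) := (continuous_steinhausSum a).measurable
    exact hg.aestronglyMeasurable.comp_measurable hmeas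
  · simpa using norm_steinhausSum_le a θ

theorem steinhausSum_insertNth {n : ℕ} (a : Fin (n + 1) → ℂ) (k : Fin (n + 1)) (x : ℝ)
    (θ : Fin n → ℝ) :
    steinhausSum a (k.insertNth x θ) =
      a k * Complex.exp (x * Complex.I) + steinhausSum (k.removeNth a) θ := by
  simp [steinhausSum, Fin.sum_univ_succAbove _ k, Fin.removeNth]

/-- Integrating one of the angles first. -/
theorem integral_comp_steinhausSum {n : ℕ} (a : Fin (n + 1) → ℂ) (k : Fin (n + 1)) {E : Type*}
    [NormedAddCommGroup E] [NormedSpace ℝ E] {g : ℂ → E} (hg : Continuous g) :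
    ∫ θ, g (steinhausSum a θ) ∂angles (n + 1) =
      ∫ θ, (∫ x : ℝ, g (a k * Complex.exp (x * Complex.I) + steinhausSum (k.removeNth a) θ)
        ∂angleMeasure) ∂angles n := by
  have hmp := (measurePreserving_piFinSuccAbove (fun _ : Fin (n + 1) => angleMeasure) k).symm
  have hint := hmp.integrable_comp_of_integrable (integrable_comp_steinhausSum a hg)
  rw [← hmp.integral_comp']
  refine (integral_prod_symm _ hint).trans ?_
  refine integral_congr_ae (ae_of_all _ fun θ => ?_)
  refine integral_congr_ae (ae_of_all _ fun x => ?_)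
  simp only [← steinhausSum_insertNth]
  rfl

theorem norm_mul_add_sq (a w z : ℂ) (hz : ‖z‖ = 1) :
    ‖a * z + w‖ ^ 2 = ‖a‖ ^ 2 + ‖w‖ ^ 2 + 2 * (a * star w * z).re := by
  rw [Complex.sq_norm, Complex.normSq_add, ← Complex.sq_norm, ← Complex.sq_norm, norm_mul, hz,
    mul_one]
  congr 3
  simp only [Complex.star_def]
  ring

theorem re_sq_eq (w : ℂ) : w.re ^ 2 = (‖w‖ ^ 2 + (w ^ 2).re) / 2 := by
  rw [Complex.sq_norm, Complex.normSq_apply, sq w, Complex.mul_re]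
  ring

theorem integral_norm_mul_exp_add_sq (a w : ℂ) :
    ∫ x : ℝ, ‖a * Complex.exp (x * Complex.I) + w‖ ^ 2 ∂angleMeasure = ‖a‖ ^ 2 + ‖w‖ ^ 2 := by
  have h := integral_angleMeasure_re_mul_exp_pow one_ne_zero (a * star w)
  simp only [pow_one] at h
  simp only [norm_mul_add_sq a w _ (Complex.norm_exp_ofReal_mul_I _)]
  rw [integral_add (integrable_const _) (integrable_angleMeasure (by fun_prop)),
    integral_const_mul, h]
  simp

theorem integral_norm_mul_exp_add_pow_four (a w : ℂ) :
    ∫ x : ℝ, ‖a * Complex.exp (x * Complex.I) + w‖ ^ 4 ∂angleMeasure =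
      (‖a‖ ^ 2 + ‖w‖ ^ 2) ^ 2 + 2 * ‖a‖ ^ 2 * ‖w‖ ^ 2 := by
  have h := integral_angleMeasure_re_mul_exp_pow one_ne_zero (a * star w)
  have h' := integral_angleMeasure_re_mul_exp_pow two_ne_zero ((a * star w) ^ 2)
  simp only [pow_one] at h
  have e : ∀ x : ℝ, ‖a * Complex.exp (x * Complex.I) + w‖ ^ 4 =
      ((‖a‖ ^ 2 + ‖w‖ ^ 2) ^ 2 + 2 * ‖a‖ ^ 2 * ‖w‖ ^ 2) +
      (4 * (‖a‖ ^ 2 + ‖w‖ ^ 2) * (a * star w * Complex.exp (x * Complex.I)).re +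
        2 * ((a * star w) ^ 2 * Complex.exp (x * Complex.I) ^ 2).re) := fun x => by
    have e1 := norm_mul_add_sq a w _ (Complex.norm_exp_ofReal_mul_I x)
    have e2 := re_sq_eq (a * star w * Complex.exp (x * Complex.I))
    have e3 : ‖a * star w * Complex.exp (x * Complex.I)‖ = ‖a‖ * ‖w‖ := by
      rw [norm_mul, norm_mul, Complex.norm_exp_ofReal_mul_I, norm_star, mul_one]
    rw [e3, mul_pow (a * star w)] at e2
    rw [show ‖a * Complex.exp (x * Complex.I) + w‖ ^ 4 =
      (‖a * Complex.exp (x * Complex.I) + w‖ ^ 2) ^ 2 by ring, e1]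
    linear_combination 4 * e2
  simp only [e]
  rw [integral_add (integrable_const _) (integrable_angleMeasure (by fun_prop)), integral_const,
    integral_add (integrable_angleMeasure (by fun_prop)) (integrable_angleMeasure (by fun_prop)),
    integral_const_mul, integral_const_mul, h, h']
  simp

theorem integral_norm_steinhausSum_sq {n : ℕ} (a : Fin n → ℂ) :
    ∫ θ, ‖steinhausSum a θ‖ ^ 2 ∂angles n = ∑ j, ‖a j‖ ^ 2 := by
  induction n with
  | zero => simp [steinhausSum]
  | succ n ih =>
    rw [integral_comp_steinhausSum a 0 (g := fun z => ‖z‖ ^ 2) (by fun_prop)]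
    simp only [integral_norm_mul_exp_add_sq]
    rw [integral_add (integrable_const _)
      (integrable_comp_steinhausSum _ (g := fun z => ‖z‖ ^ 2) (by fun_prop)), ih,
      Fin.sum_univ_succ]
    simp [Fin.removeNth]

/-- Adding one independent phase sends the bound 2R² to |a₀|⁴ + 4|a₀|²R + 2R², which is at most
2(|a₀|² + R)². -/
theorem integral_norm_steinhausSum_pow_four_le {n : ℕ} (a : Fin n → ℂ) :
    ∫ θ, ‖steinhausSum a θ‖ ^ 4 ∂angles n ≤ 2 * (∑ j, ‖a j‖ ^ 2) ^ 2 := by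
  induction n with
  | zero => simp [steinhausSum]
  | succ n ih =>
    rw [integral_comp_steinhausSum a 0 (g := fun z => ‖z‖ ^ 4) (by fun_prop)]
    simp only [integral_norm_mul_exp_add_pow_four]
    have e : ∀ θ : Fin n → ℝ, (‖a 0‖ ^ 2 + ‖steinhausSum (Fin.removeNth 0 a) θ‖ ^ 2) ^ 2 +
        2 * ‖a 0‖ ^ 2 * ‖steinhausSum (Fin.removeNth 0 a) θ‖ ^ 2 = ‖a 0‖ ^ 4 +
          (4 * ‖a 0‖ ^ 2 * ‖steinhausSum (Fin.removeNth 0 a) θ‖ ^ 2 +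
            ‖steinhausSum (Fin.removeNth 0 a) θ‖ ^ 4) := fun θ => by ring
    simp only [e]
    have i2 := integrable_comp_steinhausSum (Fin.removeNth 0 a) (g := fun z => ‖z‖ ^ 2)
      (by fun_prop)
    have i4 := integrable_comp_steinhausSum (Fin.removeNth 0 a) (g := fun z => ‖z‖ ^ 4)
      (by fun_prop)
    have i24 : Integrable (fun θ => 4 * ‖a 0‖ ^ 2 * ‖steinhausSum (Fin.removeNth 0 a) θ‖ ^ 2 +
        ‖steinhausSum (Fin.removeNth 0 a) θ‖ ^ 4) (angles n) := (i2.const_mul _).add i4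
    rw [integral_add (integrable_const _) i24,
      integral_add (i2.const_mul _) i4, integral_const_mul, integral_norm_steinhausSum_sq,
      Fin.sum_univ_succ]
    have := ih (Fin.removeNth 0 a)
    simp only [Fin.removeNth, Fin.succAbove_zero, integral_const, probReal_univ, one_smul] at this ⊢
    nlinarith [sq_nonneg (‖a 0‖ ^ 2)]

/-- Multiplying by the unimodular exp(-ix) does not change the modulus, and a + w exp(-ix) has mean
a. -/
theorem norm_le_integral_norm_mul_exp_add (a w : ℂ) :
    ‖a‖ ≤ ∫ x : ℝ, ‖a * Complex.exp (x * Complex.I) + w‖ ∂angleMeasure := by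
  have e : ∫ x : ℝ, (a + star (star w * Complex.exp (x * Complex.I))) ∂angleMeasure = a := by
    have h0 : ∫ x : ℝ, star (star w * Complex.exp (x * Complex.I)) ∂angleMeasure = 0 := by
      have := integral_conj (𝕜 := ℂ) (μ := angleMeasure)
        (f := fun x : ℝ => star w * Complex.exp (x * Complex.I))
      have h1 := integral_angleMeasure_exp_pow one_ne_zero
      simp only [pow_one] at h1
      rw [integral_const_mul, h1] at this
      simpa using this
    rw [integral_add (integrable_const _) (integrable_angleMeasure (by fun_prop)), h0]
    simp
  calc ‖a‖ = ‖∫ x : ℝ, (a + star (star w * Complex.exp (x * Complex.I))) ∂angleMeasure‖ := by rw [e]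
    _ ≤ ∫ x : ℝ, ‖a + star (star w * Complex.exp (x * Complex.I))‖ ∂angleMeasure :=
      norm_integral_le_integral_norm _
    _ = _ := by
      refine integral_congr_ae (ae_of_all _ fun x => ?_)
      have hz := Complex.norm_exp_ofReal_mul_I x
      have hz' : Complex.exp (x * Complex.I) * star (Complex.exp (x * Complex.I)) = 1 := by
        rw [Complex.star_def, Complex.mul_conj, Complex.normSq_eq_norm_sq, hz]
        simp
      dsimp only
      rw [← mul_one ‖a + _‖, ← hz, ← norm_mul]
      congr 1
      simp only [star_mul', star_star]
      linear_combination w * hz'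

theorem integrable_integral_norm_mul_exp_add {n : ℕ} (a : Fin (n + 1) → ℂ) (k : Fin (n + 1)) :
    Integrable (fun θ => ∫ x : ℝ, ‖a k * Complex.exp (x * Complex.I) +
      steinhausSum (k.removeNth a) θ‖ ∂angleMeasure) (angles n) := by
  have hmp := (measurePreserving_piFinSuccAbove (fun _ : Fin (n + 1) => angleMeasure) k).symm
  have hint := hmp.integrable_comp_of_integrable
    (integrable_comp_steinhausSum a (g := fun z => ‖z‖) (by fun_prop))
  refine hint.integral_prod_right.congr (ae_of_all _ fun θ => ?_)
  refine integral_congr_ae (ae_of_all _ fun x => ?_)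
  simp only [← steinhausSum_insertNth]
  rfl

theorem norm_le_integral_norm_steinhausSum {n : ℕ} (a : Fin n → ℂ) (k : Fin n) :
    ‖a k‖ ≤ ∫ θ, ‖steinhausSum a θ‖ ∂angles n := by
  obtain _ | n := n
  · exact k.elim0
  rw [integral_comp_steinhausSum a k (g := fun z => ‖z‖) (by fun_prop)]
  have := integral_mono (integrable_const ‖a k‖) (integrable_integral_norm_mul_exp_add a k)
    fun θ => norm_le_integral_norm_mul_exp_add (a k) (steinhausSum (k.removeNth a) θ)
  simpa using this

/-! ### Khinchine's inequality when one coefficient carries half of the ℓ² mass. -/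

/-- The mean value property of holomorphic functions, for the uniform angle. -/
theorem integral_angleMeasure_comp_mul_exp {F : ℂ → ℂ}
    (hF : ∀ z : ℂ, ‖z‖ ≤ 1 → DifferentiableAt ℂ F z) {c : ℂ} (hc : ‖c‖ ≤ 1) :
    ∫ x : ℝ, F (c * Complex.exp (x * Complex.I)) ∂angleMeasure = F 0 := by
  have hd : DiffContOnCl ℂ (fun z => F (c * z)) (Metric.ball 0 |1|) := by
    apply DifferentiableOn.diffContOnCl
    intro z hz
    have hz1 : ‖z‖ ≤ 1 := by
      have := Metric.closure_ball_subset_closedBall hz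
      simpa using this
    have h1 : ‖c * z‖ ≤ 1 := by
      rw [norm_mul]
      exact mul_le_one₀ hc (norm_nonneg _) hz1
    exact ((hF _ h1).comp z ((differentiableAt_id).const_mul c)).differentiableWithinAt
  have h := hd.circleAverage
  rw [Real.circleAverage_def] at h
  rw [integral_angleMeasure]
  simpa [circleMap] using h

/-- Since |1 + z| = |√(1 + z)|², Parseval gives the mean as ∑ binom(1/2, k)² |c|^(2k), and the left
side is the start of this series. The proof needs no infinite series: it replaces √(1 + z) by its
Taylor polynomial P and makes the error average to zero. -/
theorem one_add_le_integral_norm_one_add {c : ℂ} (hc : ‖c‖ ≤ 1) :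
    1 + ‖c‖ ^ 2 / 4 + ‖c‖ ^ 4 / 64 ≤
      ∫ x : ℝ, ‖1 + c * Complex.exp (x * Complex.I)‖ ∂angleMeasure := by
  set P : ℂ → ℂ := fun z => 1 + z / 2 - z ^ 2 / 8 with hP
  have hP0 : ∀ z : ℂ, ‖z‖ ≤ 1 → P z ≠ 0 := by
    intro z hz h
    have h1 : (1 : ℂ) = z ^ 2 / 8 - z / 2 := by
      simp only [hP] at h
      linear_combination h
    have h2 : ‖(1 : ℂ)‖ ≤ ‖z ^ 2 / 8‖ + ‖z / 2‖ := by
      conv_lhs => rw [h1]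
      exact norm_sub_le _ _
    simp only [norm_one, norm_div, norm_pow, RCLike.norm_ofNat] at h2
    nlinarith [norm_nonneg z]
  set ρ : ℂ := ((‖c‖ ^ 2 : ℝ) : ℂ) with hρ
  -- On the circle |z| = |c| one has conj z = ρ / z, so z³ conj(P z) becomes the polynomial in the
  -- first factor. Thus the error term F is holomorphic and vanishes at 0. G adds the part of |P|²
  -- that also averages to zero.
  set F : ℂ → ℂ := fun z => (z ^ 3 + ρ * z ^ 2 / 2 - ρ ^ 2 * z / 8) * ((8 - z) / (64 * P z)) with hF
  set G : ℂ → ℂ := fun z => F z + (z * (1 - ρ / 8) - z ^ 2 / 4) with hG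
  have hGd : ∀ z : ℂ, ‖z‖ ≤ 1 → DifferentiableAt ℂ G z := by
    intro z hz
    have : (64 : ℂ) * P z ≠ 0 := mul_ne_zero (by norm_num) (hP0 z hz)
    simp only [hG, hF, hP] at this ⊢
    fun_prop (disch := assumption)
  have hmean := integral_angleMeasure_comp_mul_exp hGd hc
  have hG0 : G 0 = 0 := by simp [hG, hF]
  rw [hG0] at hmean
  have hnorm : ∀ x : ℝ, ‖c * Complex.exp (x * Complex.I)‖ = ‖c‖ := fun x => by
    rw [norm_mul, Complex.norm_exp_ofReal_mul_I, mul_one]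
  have hcont : Continuous fun x : ℝ => G (c * Complex.exp (x * Complex.I)) := by
    refine continuous_iff_continuousAt.2 fun x => ?_
    refine ContinuousAt.comp (f := fun x : ℝ => c * Complex.exp (x * Complex.I))
      (hGd _ ((hnorm x).trans_le hc)).continuousAt ?_
    fun_prop
  -- `1 + z = P² + z³ (8 - z) / 64`, tested against the unimodular `P / conj P`
  have hpt : ∀ z : ℂ, ‖z‖ = ‖c‖ → 1 + ‖c‖ ^ 2 / 4 + ‖c‖ ^ 4 / 64 + (G z).re ≤ ‖1 + z‖ := by
    intro z hz
    have hPz := hP0 z (hz.trans_le hc)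
    have hzz : z * star z = ρ := by
      rw [Complex.star_def, Complex.mul_conj, Complex.normSq_eq_norm_sq, hz]
    have hs : star (P z) = 1 + star z / 2 - (star z) ^ 2 / 8 := by
      simp [hP]
    have hrec : ((1 + z) * star (P z) / P z) = P z * star (P z) + F z := by
      rw [hs]
      simp only [hF]
      rw [← hzz]
      have h1 : 1 + z = P z ^ 2 + z ^ 3 * (8 - z) / 64 := by
        simp only [hP]; ring
      rw [h1]
      field_simp
    have hle : ((1 + z) * star (P z) / P z).re ≤ ‖1 + z‖ := by
      refine (Complex.re_le_norm _).trans_eq ?_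
      rw [norm_div, norm_mul, norm_star, mul_div_assoc, div_self (norm_ne_zero_iff.2 hPz), mul_one]
    have hPP : (P z * star (P z)).re = 1 + ‖c‖ ^ 2 / 4 + ‖c‖ ^ 4 / 64 +
        (z * (1 - ρ / 8) - z ^ 2 / 4).re := by
      have e : P z * star (P z) = ((1 + ‖c‖ ^ 2 / 4 + ‖c‖ ^ 4 / 64 : ℝ) : ℂ) +
          ((z + star z) * (1 / 2 - ρ / 16) - (z ^ 2 + star z ^ 2) / 8) := by
        have e4 : ((‖c‖ ^ 4 : ℝ) : ℂ) = ρ ^ 2 := by rw [hρ]; push_cast; ring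
        have e2 : ((‖c‖ ^ 2 : ℝ) : ℂ) = ρ := rfl
        rw [hs, Complex.ofReal_add, Complex.ofReal_add, Complex.ofReal_div, Complex.ofReal_div, e4,
          e2, ← hzz]
        simp only [hP]
        push_cast
        ring
      have e' : (z + star z) * (1 / 2 - ρ / 16) - (z ^ 2 + star z ^ 2) / 8 =
          ((1 / 2 : ℝ) : ℂ) * ((z * (1 - ρ / 8) - z ^ 2 / 4) +
            star (z * (1 - ρ / 8) - z ^ 2 / 4)) := by
        have hρs : star ρ = ρ := Complex.conj_ofReal _
        simp only [star_sub, star_mul', star_div₀, star_pow, star_one, star_ofNat, hρs]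
        push_cast
        ring
      rw [e, e', Complex.add_re, Complex.ofReal_re, Complex.re_ofReal_mul, Complex.add_re,
        Complex.star_def, Complex.conj_re]
      ring
    rw [hrec, Complex.add_re, hPP] at hle
    simp only [hG, Complex.add_re]
    linarith
  have hcre : Continuous fun x : ℝ => (G (c * Complex.exp (x * Complex.I))).re :=
    Complex.continuous_re.comp hcont
  have hre : ∫ x : ℝ, (G (c * Complex.exp (x * Complex.I))).re ∂angleMeasure = 0 := by
    have h := integral_re (𝕜 := ℂ) (integrable_angleMeasure hcont)
    simp only [RCLike.re_to_complex] at h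
    rw [h, hmean, Complex.zero_re]
  calc 1 + ‖c‖ ^ 2 / 4 + ‖c‖ ^ 4 / 64 = ∫ x : ℝ, (1 + ‖c‖ ^ 2 / 4 + ‖c‖ ^ 4 / 64 +
        (G (c * Complex.exp (x * Complex.I))).re) ∂angleMeasure := by
        rw [integral_add (integrable_const _) (integrable_angleMeasure hcre), hre]
        simp
    _ ≤ _ := integral_mono (integrable_angleMeasure (continuous_const.add hcre))
        (integrable_angleMeasure (by fun_prop)) fun x => hpt _ (hnorm x)

theorem norm_mul_exp_add_eq (a w : ℂ) (x : ℝ) :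
    ‖a * Complex.exp (x * Complex.I) + w‖ = ‖star a + star w * Complex.exp (x * Complex.I)‖ := by
  have hz := Complex.norm_exp_ofReal_mul_I x
  have hz' : Complex.exp (x * Complex.I) * star (Complex.exp (x * Complex.I)) = 1 := by
    rw [Complex.star_def, Complex.mul_conj, Complex.normSq_eq_norm_sq, hz]
    simp
  rw [← norm_star, ← mul_one ‖star (_ + w)‖, ← hz, ← norm_mul]
  congr 1
  simp only [star_add, star_mul']
  linear_combination star a * hz'

theorem quartic_le_of_one_le {r : ℝ} (hr : 1 ≤ r) :
    0.985 + 0.282 * r ^ 2 - 0.006 * r ^ 4 ≤ r * (1 + (1 / r) ^ 2 / 4 + (1 / r) ^ 4 / 64) := by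
  have hr0 : 0 < r := by linarith
  -- This is the difference of the two sides multiplied by 64 r³.
  have key : 0 ≤ 0.384 * r ^ 7 - 18.048 * r ^ 5 + 64 * r ^ 4 - 63.04 * r ^ 3 + 16 * r ^ 2 + 1 := by
    rcases le_total r 2.5 with h | h
    · have ht : 0 ≤ r - 1 := by linarith
      set t := r - 1 with htd
      have e : r = 1 + t := by rw [htd]; ring
      have h1 : 0 ≤ t ^ 2 * (38 + 25 * t - 13 * t ^ 2 - 10 * t ^ 3) := by
        refine mul_nonneg (sq_nonneg t) ?_
        have h15 : 0 ≤ 1.5 - t := by linarith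
        nlinarith [mul_nonneg ht h15, mul_nonneg (mul_nonneg ht ht) h15]
      rw [e]
      nlinarith [h1, pow_nonneg ht 2, pow_nonneg ht 3, pow_nonneg ht 4, pow_nonneg ht 5,
        pow_nonneg ht 6, pow_nonneg ht 7]
    -- The quintic factor below has its local minimum close to r = 3.3, hence the expansion around
    -- that point.
    · have hs : -0.8 ≤ r - 3.3 := by linarith
      set s := r - 3.3 with hsd
      have e : r = 3.3 + s := by rw [hsd]; ring
      have h8 : 0 ≤ s + 0.8 := by linarith
      have h1 : 0 ≤ 0.384 * r ^ 5 - 18.048 * r ^ 3 + 64 * r ^ 2 - 63.04 * r + 16 := by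
        have h2 : 0 ≤ s ^ 2 * (15.2 + 23 * s + 6.3 * s ^ 2 + 0.384 * s ^ 3) := by
          refine mul_nonneg (sq_nonneg s) ?_
          nlinarith [pow_nonneg h8 2, pow_nonneg h8 3]
        rw [e]
        nlinarith [h2, sq_nonneg (s - 0.16), mul_nonneg (sq_nonneg s) h8, pow_nonneg h8 2,
          mul_nonneg (sq_nonneg s) (pow_nonneg h8 2)]
      have e2 : 0.384 * r ^ 7 - 18.048 * r ^ 5 + 64 * r ^ 4 - 63.04 * r ^ 3 + 16 * r ^ 2 + 1 =
          (0.384 * r ^ 5 - 18.048 * r ^ 3 + 64 * r ^ 2 - 63.04 * r + 16) * r ^ 2 + 1 := by ring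
      rw [e2]
      positivity
  have e : r * (1 + (1 / r) ^ 2 / 4 + (1 / r) ^ 4 / 64) - (0.985 + 0.282 * r ^ 2 - 0.006 * r ^ 4) =
      (0.384 * r ^ 7 - 18.048 * r ^ 5 + 64 * r ^ 4 - 63.04 * r ^ 3 + 16 * r ^ 2 + 1) /
        (64 * r ^ 3) := by
    field_simp
    ring
  have : 0 ≤ (0.384 * r ^ 7 - 18.048 * r ^ 5 + 64 * r ^ 4 - 63.04 * r ^ 3 + 16 * r ^ 2 + 1) /
        (64 * r ^ 3) := by positivity
  linarith

/-- Only ‖w‖² and ‖w‖⁴ occur, so when w is a Steinhaus sum the bound can be averaged from its second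
and fourth moments. The quartic coefficient is negative, so an upper bound for the fourth moment
suffices. For ‖w‖ > ‖a‖ the roles of a and w are exchanged. -/
theorem le_integral_norm_mul_exp_add {a : ℂ} (ha : a ≠ 0) (w : ℂ) :
    0.985 * ‖a‖ + 0.282 * ‖w‖ ^ 2 / ‖a‖ - 0.006 * ‖w‖ ^ 4 / ‖a‖ ^ 3 ≤
      ∫ x : ℝ, ‖a * Complex.exp (x * Complex.I) + w‖ ∂angleMeasure := by
  have ha' : 0 < ‖a‖ := norm_pos_iff.2 ha
  set r := ‖w‖ / ‖a‖ with hr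
  have hlhs : 0.985 * ‖a‖ + 0.282 * ‖w‖ ^ 2 / ‖a‖ - 0.006 * ‖w‖ ^ 4 / ‖a‖ ^ 3 =
      ‖a‖ * (0.985 + 0.282 * r ^ 2 - 0.006 * r ^ 4) := by
    rw [hr]
    field_simp
  rw [hlhs]
  rcases le_total ‖w‖ ‖a‖ with h | h
  · have e : ∀ x : ℝ, ‖a * Complex.exp (x * Complex.I) + w‖ =
        ‖a‖ * ‖1 + (star w / star a) * Complex.exp (x * Complex.I)‖ := fun x => by
      have : star a ≠ 0 := star_ne_zero.2 ha
      rw [norm_mul_exp_add_eq, ← norm_star a, ← norm_mul]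
      congr 1
      field_simp
    simp only [e]
    rw [integral_const_mul]
    have hc : ‖star w / star a‖ = r := by rw [norm_div, norm_star, norm_star]
    have hr1 : r ≤ 1 := (div_le_one ha').2 h
    have := one_add_le_integral_norm_one_add (hc.trans_le hr1)
    rw [hc] at this
    refine mul_le_mul_of_nonneg_left (le_trans ?_ this) ha'.le
    nlinarith [sq_nonneg (r ^ 2 - 0.74)]
  · have hw : w ≠ 0 := norm_pos_iff.1 (ha'.trans_le h)
    have hw' : 0 < ‖w‖ := norm_pos_iff.2 hw
    have e : ∀ x : ℝ, ‖a * Complex.exp (x * Complex.I) + w‖ =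
        ‖w‖ * ‖1 + (a / w) * Complex.exp (x * Complex.I)‖ := fun x => by
      rw [← norm_mul]
      congr 1
      field_simp
      ring
    simp only [e]
    rw [integral_const_mul]
    have hr1 : 1 ≤ r := (one_le_div ha').2 h
    have hc : ‖a / w‖ = 1 / r := by rw [norm_div, hr, one_div_div]
    have := one_add_le_integral_norm_one_add (c := a / w) (by
      rw [hc]
      exact (div_le_one (by linarith)).2 hr1)
    rw [hc] at this
    have h2 := quartic_le_of_one_le hr1
    calc ‖a‖ * (0.985 + 0.282 * r ^ 2 - 0.006 * r ^ 4)
        ≤ ‖a‖ * (r * (1 + (1 / r) ^ 2 / 4 + (1 / r) ^ 4 / 64)) := by gcongr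
      _ = ‖w‖ * (1 + (1 / r) ^ 2 / 4 + (1 / r) ^ 4 / 64) := by
        rw [← mul_assoc, hr, mul_div_cancel₀ _ ha'.ne']
      _ ≤ _ := by gcongr

/-- The number 0.8863 lies just above √π/2 = 0.88622…. Averaging over the k-th angle first leaves a
one-variable inequality in A = ‖a k‖ ≥ 1/√2. -/
theorem le_integral_norm_steinhausSum_of_large {n : ℕ} {a : Fin n → ℂ} (ha : ∑ j, ‖a j‖ ^ 2 = 1)
    {k : Fin n} (hk : 1 / 2 ≤ ‖a k‖ ^ 2) :
    0.8863 ≤ ∫ θ, ‖steinhausSum a θ‖ ∂angles n := by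
  obtain _ | n := n
  · exact k.elim0
  have hpos : 0 < ‖a k‖ := by
    by_contra! h
    have : ‖a k‖ = 0 := le_antisymm h (norm_nonneg _)
    rw [this] at hk
    norm_num at hk
  have hQ : ∑ j, ‖k.removeNth a j‖ ^ 2 = 1 - ‖a k‖ ^ 2 := by
    rw [← ha, Fin.sum_univ_succAbove _ k]
    simp [Fin.removeNth]
  have i2 := integrable_comp_steinhausSum (k.removeNth a) (g := fun z => ‖z‖ ^ 2) (by fun_prop)
  have i4 := integrable_comp_steinhausSum (k.removeNth a) (g := fun z => ‖z‖ ^ 4) (by fun_prop)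
  have m2 := integral_norm_steinhausSum_sq (k.removeNth a)
  have m4 := integral_norm_steinhausSum_pow_four_le (k.removeNth a)
  rw [hQ] at m2 m4
  set A := ‖a k‖ with hA
  have hA1 : A ≤ 1 := by
    have : 0 ≤ 1 - A ^ 2 := by
      rw [← hQ]
      positivity
    nlinarith
  have hA2 : 0.7 ≤ A := by nlinarith
  have i2' : Integrable (fun θ => 0.282 * ‖steinhausSum (k.removeNth a) θ‖ ^ 2 / A) (angles n) :=
    (i2.const_mul _).div_const _
  have i4' : Integrable (fun θ => 0.006 * ‖steinhausSum (k.removeNth a) θ‖ ^ 4 / A ^ 3)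
    (angles n) := (i4.const_mul _).div_const _
  have i24 : Integrable (fun θ => 0.985 * A + 0.282 * ‖steinhausSum (k.removeNth a) θ‖ ^ 2 / A)
    (angles n) := (integrable_const _).add i2'
  have hlow : ∫ θ, (0.985 * A + 0.282 * ‖steinhausSum (k.removeNth a) θ‖ ^ 2 / A -
      0.006 * ‖steinhausSum (k.removeNth a) θ‖ ^ 4 / A ^ 3) ∂angles n ≤
        ∫ θ, ‖steinhausSum a θ‖ ∂angles (n + 1) := by
    rw [integral_comp_steinhausSum a k (g := fun z => ‖z‖) (by fun_prop)]
    exact integral_mono (i24.sub i4')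
      (integrable_integral_norm_mul_exp_add a k)
      fun θ => le_integral_norm_mul_exp_add (norm_pos_iff.1 hpos) _
  refine le_trans ?_ hlow
  rw [integral_sub i24 i4', integral_add (integrable_const _) i2', integral_div, integral_div,
    integral_const, integral_const_mul, m2, integral_const_mul 0.006]
  simp only [probReal_univ, one_smul]
  set q := ∫ θ, ‖steinhausSum (k.removeNth a) θ‖ ^ 4 ∂angles n
  have hq : 0.006 * q / A ^ 3 ≤ 0.006 * (2 * (1 - A ^ 2) ^ 2) / A ^ 3 := by gcongr
  have e : 0.985 * A + 0.282 * (1 - A ^ 2) / A - 0.006 * (2 * (1 - A ^ 2) ^ 2) / A ^ 3 - 0.8863 =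
      (0.691 * A ^ 4 - 0.8863 * A ^ 3 + 0.306 * A ^ 2 - 0.012) / A ^ 3 := by
    field_simp
    ring
  have : 0 ≤ (0.691 * A ^ 4 - 0.8863 * A ^ 3 + 0.306 * A ^ 2 - 0.012) / A ^ 3 := by
    refine div_nonneg ?_ (by positivity)
    have ht : 0 ≤ A - 0.7071 := by nlinarith
    nlinarith [pow_nonneg ht 2, pow_nonneg ht 3, pow_nonneg ht 4]
  linarith

/-! ### The Bessel functions J₀ and J₁: differential equations and numerical bounds. -/

/-- The Bessel function `J₀`, as an average over the angle. -/
noncomputable def besselZero (t : ℝ) : ℝ := ∫ x, Real.cos (t * Real.cos x) ∂angleMeasure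

/-- The Bessel function `J₁`, as an average over the angle. -/
noncomputable def besselOne (t : ℝ) : ℝ :=
  ∫ x, Real.sin (t * Real.cos x) * Real.cos x ∂angleMeasure

theorem hasDerivAt_integral_angleMeasure {f f' : ℝ → ℝ → ℝ} (hf : ∀ t, Continuous (f t))
    (hf' : ∀ t, Continuous (f' t)) (hd : ∀ t x, HasDerivAt (fun t => f t x) (f' t x) t)
    (hb : ∀ t x, |f' t x| ≤ 1) (t : ℝ) :
    HasDerivAt (fun t => ∫ x, f t x ∂angleMeasure) (∫ x, f' t x ∂angleMeasure) t :=
  (hasDerivAt_integral_of_dominated_loc_of_deriv_le (F := f) (F' := f') (bound := fun _ => 1)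
    Filter.univ_mem (Filter.Eventually.of_forall fun t => (hf t).aestronglyMeasurable)
    (integrable_angleMeasure (hf t)) (hf' t).aestronglyMeasurable
    (ae_of_all _ fun x t _ => hb t x) (integrable_const _)
    (ae_of_all _ fun x t _ => hd t x)).2

theorem hasDerivAt_besselZero (t : ℝ) : HasDerivAt besselZero (-besselOne t) t := by
  have h := hasDerivAt_integral_angleMeasure (f := fun t x => Real.cos (t * Real.cos x))
    (f' := fun t x => -(Real.sin (t * Real.cos x) * Real.cos x)) (by fun_prop) (by fun_prop)
    (fun t x => by
      have := ((hasDerivAt_id t).mul_const (Real.cos x)).cos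
      simpa using this)
    (fun t x => by
      rw [abs_neg, abs_mul]
      exact mul_le_one₀ (Real.abs_sin_le_one _) (abs_nonneg _) (Real.abs_cos_le_one _)) t
  rw [integral_neg] at h
  exact h

theorem hasDerivAt_besselOne {t : ℝ} (ht : t ≠ 0) :
    HasDerivAt besselOne (besselZero t - besselOne t / t) t := by
  have h := hasDerivAt_integral_angleMeasure
    (f := fun t x => Real.sin (t * Real.cos x) * Real.cos x)
    (f' := fun t x => Real.cos (t * Real.cos x) * Real.cos x * Real.cos x)
    (by fun_prop) (by fun_prop)
    (fun t x => by
      have := (((hasDerivAt_id t).mul_const (Real.cos x)).sin).mul_const (Real.cos x)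
      simpa using this)
    (fun t x => by
      rw [abs_mul, abs_mul]
      exact mul_le_one₀ (mul_le_one₀ (Real.abs_cos_le_one _) (abs_nonneg _)
        (Real.abs_cos_le_one _)) (abs_nonneg _) (Real.abs_cos_le_one _)) t
  refine h.congr_deriv ?_
  -- The integrand is the x-derivative of sin(t cos x) sin x, which is periodic; with sin² = 1 -
  -- cos² this becomes Bessel's relation.
  have hz : ∫ x, (Real.cos (t * Real.cos x) * (-t * Real.sin x ^ 2) +
      Real.sin (t * Real.cos x) * Real.cos x) ∂angleMeasure = 0 := by
    rw [integral_angleMeasure, intervalIntegral.integral_eq_sub_of_hasDerivAt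
      (f := fun x => Real.sin (t * Real.cos x) * Real.sin x)]
    · simp
    · intro x _
      have := (((Real.hasDerivAt_cos x).const_mul t).sin).mul (Real.hasDerivAt_sin x)
      exact this.congr_deriv (by ring)
    · exact Continuous.intervalIntegrable (by fun_prop) _ _
  have e : ∀ x, Real.cos (t * Real.cos x) * (-t * Real.sin x ^ 2) +
      Real.sin (t * Real.cos x) * Real.cos x = t * (Real.cos (t * Real.cos x) * Real.cos x *
        Real.cos x) + (-t * Real.cos (t * Real.cos x) + Real.sin (t * Real.cos x) * Real.cos x) :=
    fun x => by rw [Real.sin_sq]; ring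
  simp only [e] at hz
  rw [integral_add (integrable_angleMeasure (by fun_prop)) (integrable_angleMeasure (by fun_prop)),
    integral_add (integrable_angleMeasure (by fun_prop)) (integrable_angleMeasure (by fun_prop)),
    integral_const_mul, integral_const_mul] at hz
  change t * _ + (-t * besselZero t + besselOne t) = 0 at hz
  rw [eq_sub_iff_add_eq, ← eq_sub_iff_add_eq', div_eq_iff ht]
  linarith

theorem continuous_besselZero : Continuous besselZero :=
  continuous_iff_continuousAt.2 fun t => (hasDerivAt_besselZero t).continuousAt

theorem abs_besselZero_le_one (t : ℝ) : |besselZero t| ≤ 1 := by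
  refine (norm_integral_le_of_norm_le_const (f := fun x => Real.cos (t * Real.cos x)) (C := 1)
    (ae_of_all _ fun x => Real.abs_cos_le_one (t * Real.cos x))).trans_eq ?_
  simp

theorem besselZero_zero : besselZero 0 = 1 := by simp [besselZero]

/-- The energy `J₀² + J₁²` is decreasing. -/
theorem antitoneOn_bessel_energy :
    AntitoneOn (fun t => besselZero t ^ 2 + besselOne t ^ 2) (Set.Ioi 0) := by
  have hd : ∀ t ∈ Set.Ioi (0 : ℝ), HasDerivAt (fun t => besselZero t ^ 2 + besselOne t ^ 2)
      (-(2 * besselOne t ^ 2 / t)) t := fun t ht => by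
    have ht' : t ≠ 0 := (Set.mem_Ioi.1 ht).ne'
    have := ((hasDerivAt_besselZero t).pow 2).add ((hasDerivAt_besselOne ht').pow 2)
    refine this.congr_deriv ?_
    field_simp
    ring
  refine antitoneOn_of_deriv_nonpos (convex_Ioi 0)
    (fun t ht => (hd t ht).continuousAt.continuousWithinAt)
    (fun t ht => (hd t (interior_subset ht)).differentiableAt.differentiableWithinAt) fun t ht => ?_
  have ht' := interior_subset ht
  rw [(hd t ht').deriv]
  have : 0 < t := ht'
  have : 0 ≤ 2 * besselOne t ^ 2 / t := by positivity
  linarith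

/-- Taylor polynomial of the cosine with `n` terms. -/
noncomputable def cosTaylor (n : ℕ) (y : ℝ) : ℝ :=
  ∑ k ∈ Finset.range n, (-1) ^ k * y ^ (2 * k) / (2 * k).factorial

/-- Taylor polynomial of the sine with `n` terms. -/
noncomputable def sinTaylor (n : ℕ) (y : ℝ) : ℝ :=
  ∑ k ∈ Finset.range n, (-1) ^ k * y ^ (2 * k + 1) / (2 * k + 1).factorial

theorem hasDerivAt_sinTaylor (n : ℕ) (y : ℝ) : HasDerivAt (sinTaylor n) (cosTaylor n y) y := by
  unfold sinTaylor cosTaylor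
  refine HasDerivAt.fun_sum fun k _ => ?_
  have := ((hasDerivAt_pow (2 * k + 1) y).const_mul ((-1 : ℝ) ^ k)).div_const
    ((2 * k + 1).factorial : ℝ)
  refine this.congr_deriv ?_
  rw [Nat.factorial_succ]
  have : ((2 * k).factorial : ℝ) ≠ 0 := by positivity
  push_cast
  have h2 : (2 * (k : ℝ) + 1) ≠ 0 := by positivity
  field_simp

theorem hasDerivAt_cosTaylor (n : ℕ) (y : ℝ) :
    HasDerivAt (cosTaylor (n + 1)) (-sinTaylor n y) y := by
  have hfun : cosTaylor (n + 1) = fun y => ∑ k ∈ Finset.range n,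
      (-1 : ℝ) ^ (k + 1) * y ^ (2 * k + 2) / (2 * k + 2).factorial + 1 := by
    funext y
    simp [cosTaylor, Finset.sum_range_succ', mul_add]
  rw [hfun, sinTaylor, ← Finset.sum_neg_distrib]
  refine HasDerivAt.add_const _ (HasDerivAt.fun_sum fun k _ => ?_)
  have := ((hasDerivAt_pow (2 * k + 2) y).const_mul ((-1 : ℝ) ^ (k + 1))).div_const
    ((2 * k + 2).factorial : ℝ)
  refine this.congr_deriv ?_
  rw [Nat.factorial_succ (2 * k + 1)]
  have : ((2 * k + 1).factorial : ℝ) ≠ 0 := by positivity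
  push_cast
  have h2 : (2 * (k : ℝ) + 1 + 1) ≠ 0 := by positivity
  field_simp
  ring

theorem nonneg_of_hasDerivAt_nonneg {f f' : ℝ → ℝ} (h0 : f 0 = 0)
    (hd : ∀ y, HasDerivAt f (f' y) y) (hf' : ∀ y, 0 ≤ y → 0 ≤ f' y) {y : ℝ} (hy : 0 ≤ y) :
    0 ≤ f y := by
  have hm : MonotoneOn f (Set.Ici 0) := by
    refine monotoneOn_of_deriv_nonneg (convex_Ici 0)
      (fun t _ => (hd t).continuousAt.continuousWithinAt)
      (fun t _ => (hd t).differentiableAt.differentiableWithinAt) fun t ht => ?_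
    rw [(hd t).deriv]
    exact hf' t (interior_subset ht)
  rw [← h0]
  exact hm (Set.mem_Ici.2 le_rfl) hy hy

/-- Each sign condition is the previous one integrated from 0, alternating between cosine and sine.
-/
theorem taylor_alternates (n : ℕ) :
    (∀ y : ℝ, 0 ≤ y → 0 ≤ (-1) ^ (n + 1) * (Real.cos y - cosTaylor (n + 1) y)) ∧
    (∀ y : ℝ, 0 ≤ y → 0 ≤ (-1) ^ (n + 1) * (Real.sin y - sinTaylor (n + 1) y)) := by
  have sin_of_cos : ∀ n : ℕ,
      (∀ y : ℝ, 0 ≤ y → 0 ≤ (-1) ^ (n + 1) * (Real.cos y - cosTaylor (n + 1) y)) →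
      (∀ y : ℝ, 0 ≤ y → 0 ≤ (-1) ^ (n + 1) * (Real.sin y - sinTaylor (n + 1) y)) :=
    fun n h y hy => nonneg_of_hasDerivAt_nonneg
      (f := fun y => (-1) ^ (n + 1) * (Real.sin y - sinTaylor (n + 1) y)) (by simp [sinTaylor])
      (fun y => ((Real.hasDerivAt_sin y).sub (hasDerivAt_sinTaylor _ y)).const_mul _) h hy
  induction n with
  | zero =>
    have h : ∀ y : ℝ, 0 ≤ y → 0 ≤ (-1) ^ (0 + 1) * (Real.cos y - cosTaylor (0 + 1) y) :=
      fun y _ => by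
        simp [cosTaylor]
        exact Real.cos_le_one y
    exact ⟨h, sin_of_cos 0 h⟩
  | succ n ih =>
    have h : ∀ y : ℝ, 0 ≤ y →
        0 ≤ (-1) ^ (n + 1 + 1) * (Real.cos y - cosTaylor (n + 1 + 1) y) := fun y hy =>
      nonneg_of_hasDerivAt_nonneg
        (f := fun y => (-1) ^ (n + 1 + 1) * (Real.cos y - cosTaylor (n + 1 + 1) y))
        (by simp [cosTaylor, Finset.sum_range_succ'])
        (fun y => ((Real.hasDerivAt_cos y).sub (hasDerivAt_cosTaylor _ y)).const_mul _)
        (fun y hy => by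
          have := ih.2 y hy
          rw [pow_succ]
          linarith) hy
    exact ⟨h, sin_of_cos _ h⟩

theorem cosTaylor_abs (n : ℕ) (y : ℝ) : cosTaylor n |y| = cosTaylor n y := by
  simp [cosTaylor, pow_mul]

theorem cosTaylor_alternates (n : ℕ) (y : ℝ) :
    0 ≤ (-1) ^ (n + 1) * (Real.cos y - cosTaylor (n + 1) y) := by
  have := (taylor_alternates n).1 |y| (abs_nonneg y)
  rwa [Real.cos_abs, cosTaylor_abs] at this

/-- The extra factor y makes the expression even, so the sign persists for negative y. It is also
the form that occurs in t J₁(t). -/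
theorem sinTaylor_alternates (n : ℕ) (y : ℝ) :
    0 ≤ (-1) ^ (n + 1) * (Real.sin y * y - sinTaylor (n + 1) y * y) := by
  have hodd : sinTaylor (n + 1) (-y) = -sinTaylor (n + 1) y := by
    simp only [sinTaylor, ← Finset.sum_neg_distrib]
    refine Finset.sum_congr rfl fun k _ => ?_
    rw [Odd.neg_pow ⟨k, rfl⟩]
    ring
  rcases le_total 0 y with hy | hy
  · have := mul_nonneg ((taylor_alternates n).2 y hy) hy
    linarith
  · have := mul_nonneg ((taylor_alternates n).2 (-y) (by linarith)) (by linarith : 0 ≤ -y)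
    rw [hodd, Real.sin_neg] at this
    linarith

theorem integral_angleMeasure_cos_pow (n : ℕ) :
    ∫ x, Real.cos x ^ (n + 2) ∂angleMeasure =
      (n + 1) / (n + 2) * ∫ x, Real.cos x ^ n ∂angleMeasure := by
  rw [integral_angleMeasure, integral_angleMeasure, integral_cos_pow]
  simp
  ring

theorem integral_cosTaylor (n : ℕ) (t : ℝ) :
    ∫ x, cosTaylor n (t * Real.cos x) ∂angleMeasure = ∑ k ∈ Finset.range n,
      (-1) ^ k * t ^ (2 * k) / (2 * k).factorial * ∫ x, Real.cos x ^ (2 * k) ∂angleMeasure := by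
  unfold cosTaylor
  rw [integral_finsetSum _ fun k _ => integrable_angleMeasure (by fun_prop)]
  refine Finset.sum_congr rfl fun k _ => ?_
  rw [← integral_const_mul]
  congr 1 with x
  ring

theorem integral_sinTaylor (n : ℕ) (t : ℝ) :
    ∫ x, sinTaylor n (t * Real.cos x) * (t * Real.cos x) ∂angleMeasure = ∑ k ∈ Finset.range n,
      (-1) ^ k * t ^ (2 * k + 2) / (2 * k + 1).factorial *
        ∫ x, Real.cos x ^ (2 * k + 2) ∂angleMeasure := by
  unfold sinTaylor
  simp only [Finset.sum_mul]
  rw [integral_finsetSum _ fun k _ => integrable_angleMeasure (by fun_prop)]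
  refine Finset.sum_congr rfl fun k _ => ?_
  rw [← integral_const_mul]
  congr 1 with x
  ring

theorem continuous_cosTaylor (n : ℕ) : Continuous (cosTaylor n) := by
  unfold cosTaylor
  fun_prop

theorem continuous_sinTaylor (n : ℕ) : Continuous (sinTaylor n) := by
  unfold sinTaylor
  fun_prop

theorem besselZero_alternates (n : ℕ) (t : ℝ) :
    0 ≤ (-1) ^ (n + 1) * (besselZero t - ∫ x, cosTaylor (n + 1) (t * Real.cos x) ∂angleMeasure) := by
  have hc := continuous_cosTaylor (n + 1)
  rw [besselZero, ← integral_sub (integrable_angleMeasure (by fun_prop))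
    (integrable_angleMeasure (by fun_prop)), ← integral_const_mul]
  exact integral_nonneg fun x => cosTaylor_alternates n _

theorem besselOne_alternates (n : ℕ) (t : ℝ) :
    0 ≤ (-1) ^ (n + 1) * (t * besselOne t -
      ∫ x, sinTaylor (n + 1) (t * Real.cos x) * (t * Real.cos x) ∂angleMeasure) := by
  have hc := continuous_sinTaylor (n + 1)
  rw [besselOne, ← integral_const_mul, ← integral_sub (integrable_angleMeasure (by fun_prop))
    (integrable_angleMeasure (by fun_prop)), ← integral_const_mul]
  refine integral_nonneg fun x => ?_
  have := sinTaylor_alternates n (t * Real.cos x)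
  simp only [Pi.zero_apply]
  linarith

theorem integral_angleMeasure_cos_moments :
    ∫ x, Real.cos x ^ 2 ∂angleMeasure = 1 / 2 ∧ ∫ x, Real.cos x ^ 4 ∂angleMeasure = 3 / 8 ∧
    ∫ x, Real.cos x ^ 6 ∂angleMeasure = 5 / 16 ∧ ∫ x, Real.cos x ^ 8 ∂angleMeasure = 35 / 128 ∧
    ∫ x, Real.cos x ^ 10 ∂angleMeasure = 63 / 256 := by
  have h0 : ∫ x, Real.cos x ^ 0 ∂angleMeasure = 1 := by simp
  have h2 := integral_angleMeasure_cos_pow 0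
  have h4 := integral_angleMeasure_cos_pow 2
  have h6 := integral_angleMeasure_cos_pow 4
  have h8 := integral_angleMeasure_cos_pow 6
  have h10 := integral_angleMeasure_cos_pow 8
  norm_num at h0 h2 h4 h6 h8 h10
  rw [h10, h8, h6, h4, h2]
  norm_num

theorem one_sub_le_besselZero (t : ℝ) : 1 - t ^ 2 / 4 ≤ besselZero t := by
  have h := besselZero_alternates 1 t
  obtain ⟨h2, -⟩ := integral_angleMeasure_cos_moments
  rw [integral_cosTaylor] at h
  norm_num [Finset.sum_range_succ, Nat.factorial, h2] at h
  linarith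

theorem besselZero_le_quartic (t : ℝ) : besselZero t ≤ 1 - t ^ 2 / 4 + t ^ 4 / 64 := by
  have h := besselZero_alternates 2 t
  obtain ⟨h2, h4, -⟩ := integral_angleMeasure_cos_moments
  rw [integral_cosTaylor] at h
  norm_num [Finset.sum_range_succ, Nat.factorial, h2, h4] at h
  linarith

theorem sextic_le_besselZero (t : ℝ) :
    1 - t ^ 2 / 4 + t ^ 4 / 64 - t ^ 6 / 2304 ≤ besselZero t := by
  have h := besselZero_alternates 3 t
  obtain ⟨h2, h4, h6, -⟩ := integral_angleMeasure_cos_moments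
  rw [integral_cosTaylor] at h
  norm_num [Finset.sum_range_succ, Nat.factorial, h2, h4, h6] at h
  linarith

/-- Consecutive partial sums of the alternating series enclose J₀(3.2) ≈ -0.320 and 3.2 J₁(3.2),
where J₁(3.2) ≈ 0.261. -/
theorem bessel_energy_le : besselZero (16 / 5) ^ 2 + besselOne (16 / 5) ^ 2 ≤ (21 / 50) ^ 2 := by
  obtain ⟨h2, h4, h6, h8, h10⟩ := integral_angleMeasure_cos_moments
  have a1 := besselZero_alternates 5 (16 / 5)
  have a2 := besselZero_alternates 4 (16 / 5)
  have b1 := besselOne_alternates 4 (16 / 5)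
  have b2 := besselOne_alternates 3 (16 / 5)
  rw [integral_cosTaylor] at a1 a2
  rw [integral_sinTaylor] at b1 b2
  norm_num [Finset.sum_range_succ, Nat.factorial, h2, h4, h6, h8, h10] at a1 a2 b1 b2
  have c1 : besselZero (16 / 5) ^ 2 ≤ (0.3208) ^ 2 := by
    rw [sq_le_sq, abs_le, abs_of_pos (by norm_num : (0 : ℝ) < 0.3208)]
    constructor <;> linarith
  have c2 : besselOne (16 / 5) ^ 2 ≤ (0.2634) ^ 2 := by
    rw [sq_le_sq, abs_le, abs_of_pos (by norm_num : (0 : ℝ) < 0.2634)]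
    constructor <;> linarith
  norm_num at c1 c2 ⊢
  linarith

/-- With x = t²/4 ≤ 1, J₀ lies between 1 - x ≥ 0 and 1 - x + x²/4, while exp(-x) ≥ 1 - x + x²/2 -
2x³/9. -/
theorem abs_besselZero_le_exp {t : ℝ} (h0 : 0 ≤ t) (ht : t ≤ 93 / 50) :
    |besselZero t| ≤ Real.exp (-(t ^ 2 / 4)) := by
  have h1 := one_sub_le_besselZero t
  have h2 := besselZero_le_quartic t
  rw [abs_of_nonneg (by nlinarith)]
  have hx1 : t ^ 2 / 4 ≤ 1 := by nlinarith
  have hx0 : 0 ≤ t ^ 2 / 4 := by positivity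
  set x := t ^ 2 / 4 with hx
  have e4 : t ^ 4 / 64 = x ^ 2 / 4 := by rw [hx]; ring
  have h3 := (abs_le.1 (Real.exp_bound (x := -x) (by rwa [abs_neg, abs_of_nonneg hx0])
    (n := 3) (by norm_num))).1
  rw [abs_neg, abs_of_nonneg hx0] at h3
  norm_num [Finset.sum_range_succ, Nat.factorial] at h3
  nlinarith [mul_nonneg (sq_nonneg x) (sub_nonneg.2 hx1)]

theorem abs_besselZero_le {t : ℝ} (ht : 93 / 50 ≤ t) : |besselZero t| ≤ 21 / 50 := by
  rcases le_total t (16 / 5) with h | h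
  · have h2 := besselZero_le_quartic t
    have h3 := sextic_le_besselZero t
    have hx1 : (0.86 : ℝ) ≤ t ^ 2 / 4 := by nlinarith
    have hx2 : t ^ 2 / 4 ≤ 2.56 := by nlinarith
    set x := t ^ 2 / 4 with hx
    have e4 : t ^ 4 / 64 = x ^ 2 / 4 := by rw [hx]; ring
    have e6 : t ^ 6 / 2304 = x ^ 3 / 36 := by rw [hx]; ring
    rw [e4] at h2 h3
    rw [e6] at h3
    rw [abs_le]
    constructor
    · nlinarith [mul_nonneg (sub_nonneg.2 hx1) (sub_nonneg.2 hx2), sq_nonneg (x - 2)]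
    · nlinarith [mul_nonneg (sub_nonneg.2 hx1) (sub_nonneg.2 hx2)]
  -- Beyond 16/5 polynomials are useless, but J₀² is at most the decreasing energy, already small
  -- enough at 16/5.
  · have h1 := antitoneOn_bessel_energy (a := 16 / 5) (b := t) (by norm_num)
      (Set.mem_Ioi.2 (by linarith)) h
    have h2 := bessel_energy_le
    refine abs_le_of_sq_le_sq ?_ (by norm_num)
    simp only at h1
    nlinarith [sq_nonneg (besselOne t)]

/-! ### First absolute moments through characteristic functions. -/

theorem lintegral_mul_exp_neg_mul {t : ℝ} (ht : 0 < t) :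
    ∫⁻ s in Set.Ioi (0 : ℝ), ENNReal.ofReal (s * Real.exp (-(s * t))) =
      ENNReal.ofReal (1 / t ^ 2) := by
  have h := Real.integral_rpow_mul_exp_neg_mul_Ioi (a := 2) (by norm_num) ht
  have e : ∫ s in Set.Ioi (0 : ℝ), s * Real.exp (-(s * t)) = 1 / t ^ 2 := by
    rw [Real.Gamma_two] at h
    norm_num at h
    rw [one_div, ← h]
    simp only [mul_comm t]
  have hint : IntegrableOn (fun s => s * Real.exp (-(s * t))) (Set.Ioi 0) := by
    by_contra hn
    rw [integral_undef hn] at e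
    have : 0 < 1 / t ^ 2 := by positivity
    linarith
  rw [← e, ofReal_integral_eq_lintegral_ofReal hint]
  refine (ae_restrict_mem measurableSet_Ioi).mono fun s hs => ?_
  have : 0 < s := hs
  simp only [Pi.zero_apply]
  positivity

theorem lintegral_one_sub_cos_mul_exp {s : ℝ} (hs : 0 < s) :
    ∫⁻ t in Set.Ioi (0 : ℝ), ENNReal.ofReal ((1 - Real.cos t) * (s * Real.exp (-(s * t)))) =
      ENNReal.ofReal ((1 + s ^ 2)⁻¹) := by
  have hre : (-(s : ℂ) + Complex.I).re < 0 := by simpa using hs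
  have hi1 := integrableOn_exp_mul_complex_Ioi hre 0
  have hI1 := integral_exp_mul_complex_Ioi hre 0
  have hi2 : IntegrableOn (fun t : ℝ => Real.exp (-s * t)) (Set.Ioi 0) :=
    integrableOn_exp_mul_Ioi (by linarith) 0
  have hI2 : ∫ t in Set.Ioi (0 : ℝ), Real.exp (-s * t) = 1 / s := by
    rw [integral_exp_mul_Ioi (by linarith) 0]
    simp
  have ecos : ∀ t : ℝ, (Complex.exp ((-(s : ℂ) + Complex.I) * t)).re =
      Real.cos t * Real.exp (-s * t) := fun t => by
    rw [Complex.exp_re]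
    simp [mul_comm]
  have hi1' : IntegrableOn (fun t : ℝ => Real.cos t * Real.exp (-s * t)) (Set.Ioi 0) := by
    have := hi1.re
    simp only [RCLike.re_to_complex, ecos] at this
    exact this
  have hI1' : ∫ t in Set.Ioi (0 : ℝ), Real.cos t * Real.exp (-s * t) = s / (1 + s ^ 2) := by
    have := integral_re (𝕜 := ℂ) hi1
    simp only [RCLike.re_to_complex, ecos] at this
    rw [this, hI1]
    simp [Complex.div_re, Complex.normSq_apply]
    field_simp
    ring
  have hint : IntegrableOn (fun t => (1 - Real.cos t) * (s * Real.exp (-(s * t)))) (Set.Ioi 0) := by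
    have := (hi2.sub hi1').const_mul s
    refine this.congr (ae_of_all _ fun t => ?_)
    simp only [Pi.sub_apply, neg_mul]
    ring
  rw [← ofReal_integral_eq_lintegral_ofReal hint]
  · congr 1
    have e : ∀ t, (1 - Real.cos t) * (s * Real.exp (-(s * t))) =
        s * (Real.exp (-s * t) - Real.cos t * Real.exp (-s * t)) := fun t => by
      rw [neg_mul]; ring
    simp only [e]
    rw [integral_const_mul, integral_sub hi2 hi1', hI2, hI1']
    field_simp
    ring
  · refine ae_of_all _ fun t => ?_
    have := Real.cos_le_one t
    simp only [Pi.zero_apply]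
    exact mul_nonneg (by linarith) (by positivity)

/-- Write 1/t² as the integral of s exp(-st) over s > 0. Tonelli then turns the integral into that
of 1/(1 + s²). Working with `∫⁻` gives integrability at the same time. -/
theorem lintegral_one_sub_cos_div_sq :
    ∫⁻ t in Set.Ioi (0 : ℝ), ENNReal.ofReal ((1 - Real.cos t) / t ^ 2) =
      ENNReal.ofReal (Real.pi / 2) := by
  calc ∫⁻ t in Set.Ioi (0 : ℝ), ENNReal.ofReal ((1 - Real.cos t) / t ^ 2)
      = ∫⁻ t in Set.Ioi (0 : ℝ), ∫⁻ s in Set.Ioi (0 : ℝ),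
          ENNReal.ofReal ((1 - Real.cos t) * (s * Real.exp (-(s * t)))) := by
        refine setLIntegral_congr_fun measurableSet_Ioi fun t ht => ?_
        have hc : 0 ≤ 1 - Real.cos t := by linarith [Real.cos_le_one t]
        simp only [ENNReal.ofReal_mul hc]
        rw [lintegral_const_mul _ (by fun_prop), lintegral_mul_exp_neg_mul ht,
          ← ENNReal.ofReal_mul hc]
        congr 1
        ring
    _ = ∫⁻ s in Set.Ioi (0 : ℝ), ∫⁻ t in Set.Ioi (0 : ℝ),
          ENNReal.ofReal ((1 - Real.cos t) * (s * Real.exp (-(s * t)))) :=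
        lintegral_lintegral_swap (by fun_prop)
    _ = ∫⁻ s in Set.Ioi (0 : ℝ), ENNReal.ofReal ((1 + s ^ 2)⁻¹) :=
        setLIntegral_congr_fun measurableSet_Ioi fun s hs => lintegral_one_sub_cos_mul_exp hs
    _ = _ := by
        rw [← ofReal_integral_eq_lintegral_ofReal integrable_inv_one_add_sq.integrableOn
          (ae_of_all _ fun s => by simp only [Pi.zero_apply]; positivity),
          integral_Ioi_inv_one_add_sq]
        simp

theorem integrableOn_one_sub_cos_div_sq :
    IntegrableOn (fun t : ℝ => (1 - Real.cos t) / t ^ 2) (Set.Ioi 0) := by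
  refine (lintegral_ofReal_ne_top_iff_integrable (Measurable.aestronglyMeasurable (by fun_prop))
    (ae_of_all _ fun t => ?_)).1 ?_
  · simp only [Pi.zero_apply]
    exact div_nonneg (by linarith [Real.cos_le_one t]) (sq_nonneg t)
  · rw [lintegral_one_sub_cos_div_sq]
    exact ENNReal.ofReal_ne_top

theorem integral_one_sub_cos_div_sq :
    ∫ t in Set.Ioi (0 : ℝ), (1 - Real.cos t) / t ^ 2 = Real.pi / 2 := by
  rw [integral_eq_lintegral_of_nonneg_ae (ae_of_all _ fun t => ?_)
    integrableOn_one_sub_cos_div_sq.aestronglyMeasurable, lintegral_one_sub_cos_div_sq,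
    ENNReal.toReal_ofReal (by positivity)]
  simp only [Pi.zero_apply]
  exact div_nonneg (by linarith [Real.cos_le_one t]) (sq_nonneg t)

theorem one_sub_cos_mul_div_sq (x t : ℝ) :
    (1 - Real.cos (t * x)) / t ^ 2 = x ^ 2 * ((1 - Real.cos (|x| * t)) / (|x| * t) ^ 2) := by
  have hc : Real.cos (t * x) = Real.cos (|x| * t) := by
    rw [← Real.cos_abs (t * x), abs_mul, ← Real.cos_abs (|x| * t), abs_mul, abs_abs, mul_comm]
  rw [hc, mul_pow, sq_abs]
  by_cases hx : x = 0
  · simp [hx]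
  · field_simp

theorem integrableOn_one_sub_cos_mul_div_sq (x : ℝ) :
    IntegrableOn (fun t : ℝ => (1 - Real.cos (t * x)) / t ^ 2) (Set.Ioi 0) := by
  by_cases hx : x = 0
  · simp [hx]
  simp only [one_sub_cos_mul_div_sq x]
  refine Integrable.const_mul ?_ _
  have := (integrableOn_Ioi_comp_mul_left_iff (fun t : ℝ => (1 - Real.cos t) / t ^ 2) 0
    (abs_pos.2 hx)).2 (by simpa using integrableOn_one_sub_cos_div_sq)
  exact this

theorem integral_one_sub_cos_mul_div_sq (x : ℝ) :
    ∫ t in Set.Ioi (0 : ℝ), (1 - Real.cos (t * x)) / t ^ 2 = Real.pi / 2 * |x| := by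
  by_cases hx : x = 0
  · simp [hx]
  simp only [one_sub_cos_mul_div_sq x]
  rw [integral_const_mul, integral_comp_mul_left_Ioi (fun t : ℝ => (1 - Real.cos t) / t ^ 2) 0
    (abs_pos.2 hx), mul_zero, integral_one_sub_cos_div_sq, ← sq_abs, smul_eq_mul]
  have := abs_ne_zero.2 hx
  field_simp

/-- The first absolute moment of a random variable in terms of its characteristic function. -/
theorem integral_abs_eq_integral_one_sub_integral_cos {Ω : Type*} [MeasurableSpace Ω]
    {P : Measure Ω} [IsProbabilityMeasure P] {X : Ω → ℝ} (hX : Measurable X)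
    (hi : Integrable X P) :
    IntegrableOn (fun t => (1 - ∫ ω, Real.cos (t * X ω) ∂P) / t ^ 2) (Set.Ioi 0) ∧
    ∫ t in Set.Ioi (0 : ℝ), (1 - ∫ ω, Real.cos (t * X ω) ∂P) / t ^ 2 =
      Real.pi / 2 * ∫ ω, |X ω| ∂P := by
  have hmeas : Measurable fun p : ℝ × Ω => (1 - Real.cos (p.1 * X p.2)) / p.1 ^ 2 := by fun_prop
  have hnorm : ∀ t x : ℝ, ‖(1 - Real.cos (t * x)) / t ^ 2‖ = (1 - Real.cos (t * x)) / t ^ 2 :=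
    fun t x => Real.norm_of_nonneg
      (div_nonneg (by linarith [Real.cos_le_one (t * x)]) (sq_nonneg t))
  have hprod : Integrable (fun p : ℝ × Ω => (1 - Real.cos (p.1 * X p.2)) / p.1 ^ 2)
      ((volume.restrict (Set.Ioi 0)).prod P) := by
    refine (integrable_prod_iff' hmeas.aestronglyMeasurable).2
      ⟨ae_of_all _ fun ω => integrableOn_one_sub_cos_mul_div_sq (X ω), ?_⟩
    simp only [hnorm, integral_one_sub_cos_mul_div_sq]
    exact hi.abs.const_mul _
  have hinner : ∀ t : ℝ, ∫ ω, (1 - Real.cos (t * X ω)) / t ^ 2 ∂P =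
      (1 - ∫ ω, Real.cos (t * X ω) ∂P) / t ^ 2 := fun t => by
    rw [integral_div, integral_sub (integrable_const _)]
    · simp
    · exact Integrable.of_bound (C := 1) (Measurable.aestronglyMeasurable (by fun_prop))
        (ae_of_all _ fun ω => Real.abs_cos_le_one _)
  constructor
  · have := hprod.integral_prod_left
    simp only [hinner] at this
    exact this
  · have := integral_integral_swap (f := fun t ω => (1 - Real.cos (t * X ω)) / t ^ 2) hprod
    simp only [hinner, integral_one_sub_cos_mul_div_sq] at this
    rw [this, integral_const_mul]

theorem re_mul_exp_mul_I (a : ℂ) (x : ℝ) :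
    (a * Complex.exp (x * Complex.I)).re = ‖a‖ * Real.cos (x + a.arg) := by
  conv_lhs => rw [← Complex.norm_mul_exp_arg_mul_I a]
  rw [mul_assoc, ← Complex.exp_add, ← add_mul, Complex.re_ofReal_mul, ← Complex.ofReal_add,
    Complex.exp_ofReal_mul_I_re, add_comm]

/-- A rotation removes the argument of a, and the imaginary part vanishes because the shift x ↦ x +
π changes the sign of cos x. -/
theorem integral_exp_mul_re (a : ℂ) (t : ℝ) :
    ∫ x : ℝ, Complex.exp ((t * (a * Complex.exp (x * Complex.I)).re : ℝ) * Complex.I)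
      ∂angleMeasure = besselZero (t * ‖a‖) := by
  simp only [re_mul_exp_mul_I]
  rw [integral_angleMeasure_add
    (f := fun x => Complex.exp ((t * (‖a‖ * Real.cos x) : ℝ) * Complex.I))
    (fun x => by simp only [Real.cos_add_two_pi])]
  have hsin : ∫ x, Real.sin (t * (‖a‖ * Real.cos x)) ∂angleMeasure = 0 := by
    have := integral_angleMeasure_add (f := fun x => Real.sin (t * (‖a‖ * Real.cos x)))
      (fun x => by simp only [Real.cos_add_two_pi]) Real.pi
    simp only [Real.cos_add_pi, mul_neg, Real.sin_neg] at this
    rw [integral_neg] at this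
    linarith
  simp only [Complex.exp_mul_I, ← Complex.ofReal_cos, ← Complex.ofReal_sin]
  rw [integral_add (integrable_angleMeasure (by fun_prop)) (integrable_angleMeasure (by fun_prop)),
    integral_mul_const, integral_complex_ofReal, integral_complex_ofReal, hsin]
  simp [besselZero, mul_assoc]

theorem integral_cos_re_steinhausSum {n : ℕ} (a : Fin n → ℂ) (t : ℝ) :
    ∫ θ, Real.cos (t * (steinhausSum a θ).re) ∂angles n = ∏ j, besselZero (t * ‖a j‖) := by
  have h : ∫ θ, Complex.exp ((t * (steinhausSum a θ).re : ℝ) * Complex.I) ∂angles n =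
      ∏ j, (besselZero (t * ‖a j‖) : ℂ) := by
    simp only [← integral_exp_mul_re]
    rw [← integral_fintype_prod_eq_prod (μ := fun _ => angleMeasure) (f := fun j (x : ℝ) =>
      Complex.exp ((t * (a j * Complex.exp (x * Complex.I)).re : ℝ) * Complex.I))]
    congr 1 with θ
    rw [← Complex.exp_sum, ← Finset.sum_mul, ← Complex.ofReal_sum, ← Finset.mul_sum,
      steinhausSum, Complex.re_sum]
  have hint := integrable_comp_steinhausSum a
    (g := fun z => Complex.exp ((t * z.re : ℝ) * Complex.I)) (by fun_prop)
  have h2 := integral_re (𝕜 := ℂ) hint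
  simp only [RCLike.re_to_complex, Complex.exp_ofReal_mul_I_re] at h2
  rw [h2, h, ← Complex.ofReal_prod, Complex.ofReal_re]

theorem integral_abs_cos : ∫ x, |Real.cos x| ∂angleMeasure = 2 / Real.pi := by
  have h := integral_angleMeasure_add (f := fun x => |Real.cos x|)
    (fun x => by simp only [Real.cos_add_two_pi]) (-(Real.pi / 2))
  rw [← h]
  simp only [← sub_eq_add_neg, Real.cos_sub_pi_div_two]
  rw [integral_angleMeasure]
  have h1 : ∫ x in (0 : ℝ)..Real.pi, |Real.sin x| = 2 := by
    rw [intervalIntegral.integral_congr (g := Real.sin)]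
    · rw [integral_sin]; norm_num
    · intro x hx
      rw [Set.uIcc_of_le Real.pi_pos.le] at hx
      exact abs_of_nonneg (Real.sin_nonneg_of_mem_Icc hx)
  have h2 : ∫ x in Real.pi..(2 * Real.pi), |Real.sin x| = 2 := by
    have := intervalIntegral.integral_comp_add_right (a := 0) (b := Real.pi)
      (fun x => |Real.sin x|) Real.pi
    simp only [Real.sin_add_pi, abs_neg, zero_add, ← two_mul] at this
    rw [← this, h1]
  rw [← intervalIntegral.integral_add_adjacent_intervals (b := Real.pi)
    (Continuous.intervalIntegrable (by fun_prop) _ _)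
    (Continuous.intervalIntegrable (by fun_prop) _ _), h1, h2, smul_eq_mul]
  field_simp
  norm_num

theorem integral_abs_re_mul_exp (z : ℂ) :
    ∫ x : ℝ, |(z * Complex.exp (x * Complex.I)).re| ∂angleMeasure = 2 / Real.pi * ‖z‖ := by
  simp only [re_mul_exp_mul_I, abs_mul, abs_norm]
  rw [integral_const_mul, integral_angleMeasure_add (f := fun x => |Real.cos x|)
    (fun x => by simp only [Real.cos_add_two_pi]), integral_abs_cos, mul_comm]

theorem integrableOn_one_sub_prod_besselZero {n : ℕ} (a : Fin n → ℂ) :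
    IntegrableOn (fun t => (1 - ∏ j, besselZero (t * ‖a j‖)) / t ^ 2) (Set.Ioi 0) := by
  have hm := (continuous_steinhausSum a).measurable
  have := (integral_abs_eq_integral_one_sub_integral_cos (P := angles n)
    (X := fun θ => (steinhausSum a θ).re) (by fun_prop)
    (integrable_comp_steinhausSum a (g := Complex.re) (by fun_prop))).1
  simpa only [integral_cos_re_steinhausSum] using this

/-- The characteristic function of Re(exp(iφ) S) depends only on the moduli of the coefficients, so
E|Re(exp(iφ) S)| is the same for all φ. Averaging over φ turns |Re| into (2/π)|S|, which cancels the
π/2 of the moment formula. -/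
theorem integral_one_sub_prod_besselZero {n : ℕ} (a : Fin n → ℂ) :
    ∫ t in Set.Ioi (0 : ℝ), (1 - ∏ j, besselZero (t * ‖a j‖)) / t ^ 2 =
      ∫ θ, ‖steinhausSum a θ‖ ∂angles n := by
  set K := ∫ t in Set.Ioi (0 : ℝ), (1 - ∏ j, besselZero (t * ‖a j‖)) / t ^ 2 with hK
  have hrot : ∀ φ : ℝ, Real.pi / 2 *
      ∫ θ, |(steinhausSum a θ * Complex.exp (φ * Complex.I)).re| ∂angles n = K := fun φ => by
    have hs : ∀ θ, steinhausSum a θ * Complex.exp (φ * Complex.I) =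
        steinhausSum (fun j => a j * Complex.exp (φ * Complex.I)) θ := fun θ => by
      simp only [steinhausSum, Finset.sum_mul]
      exact Finset.sum_congr rfl fun j _ => by ring
    have hm := (continuous_steinhausSum fun j => a j * Complex.exp (φ * Complex.I)).measurable
    have := (integral_abs_eq_integral_one_sub_integral_cos (P := angles n)
      (X := fun θ => (steinhausSum (fun j => a j * Complex.exp (φ * Complex.I)) θ).re)
      (by fun_prop) (integrable_comp_steinhausSum _ (g := Complex.re) (by fun_prop))).2
    simp only [integral_cos_re_steinhausSum, norm_mul, Complex.norm_exp_ofReal_mul_I, mul_one]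
      at this
    simp only [hs]
    exact this.symm
  have hc := continuous_steinhausSum a
  have hint : Integrable (fun p : ℝ × (Fin n → ℝ) =>
      |(steinhausSum a p.2 * Complex.exp (p.1 * Complex.I)).re|) (angleMeasure.prod (angles n)) := by
    refine Integrable.of_bound (C := ∑ j, ‖a j‖) (Continuous.aestronglyMeasurable (by fun_prop))
      (ae_of_all _ fun p => ?_)
    rw [Real.norm_eq_abs, abs_abs]
    refine (Complex.abs_re_le_norm _).trans ?_
    rw [norm_mul, Complex.norm_exp_ofReal_mul_I, mul_one]
    exact norm_steinhausSum_le a p.2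
  have hswap := integral_integral_swap (f := fun (φ : ℝ) (θ : Fin n → ℝ) =>
    |(steinhausSum a θ * Complex.exp (φ * Complex.I)).re|) hint
  simp only [integral_abs_re_mul_exp] at hswap
  rw [integral_const_mul] at hswap
  have hconst : ∀ φ : ℝ, ∫ θ, |(steinhausSum a θ * Complex.exp (φ * Complex.I)).re| ∂angles n =
      2 / Real.pi * K := fun φ => by
    rw [← hrot φ, ← mul_assoc, show 2 / Real.pi * (Real.pi / 2) = 1 by field_simp, one_mul]
  simp only [hconst] at hswap
  simp only [integral_const, probReal_univ, one_smul] at hswap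
  exact mul_left_cancel₀ (by positivity) hswap

theorem integral_norm_exp_sub_one :
    ∫ x : ℝ, ‖Complex.exp (x * Complex.I) - 1‖ ∂angleMeasure = 4 / Real.pi := by
  rw [integral_angleMeasure]
  have e : ∫ x in (0 : ℝ)..2 * Real.pi, ‖Complex.exp (x * Complex.I) - 1‖ =
      ∫ x in (0 : ℝ)..2 * Real.pi, 2 * Real.sin (x / 2) := by
    refine intervalIntegral.integral_congr fun x hx => ?_
    rw [Set.uIcc_of_le (by positivity)] at hx
    have hs : 0 ≤ Real.sin (x / 2) :=
      Real.sin_nonneg_of_nonneg_of_le_pi (by linarith [hx.1]) (by linarith [hx.2])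
    simp only [mul_comm _ Complex.I]
    rw [Complex.norm_exp_I_mul_ofReal_sub_one, Real.norm_of_nonneg (by linarith)]
  rw [e, intervalIntegral.integral_const_mul, intervalIntegral.integral_comp_div _ two_ne_zero,
    integral_sin, zero_div, mul_div_cancel_left₀ _ two_ne_zero, Real.cos_zero, Real.cos_pi]
  simp only [smul_eq_mul]
  field_simp
  norm_num

/-- The moment formula is read backwards for two coefficients of modulus 1: the mean of |exp(ix) -
exp(iy)| is an elementary integral. -/
theorem integral_one_sub_besselZero_sq :
    ∫ t in Set.Ioi (0 : ℝ), (1 - besselZero t ^ 2) / t ^ 2 = 4 / Real.pi := by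
  have h := integral_one_sub_prod_besselZero ![(1 : ℂ), -1]
  simp only [Fin.prod_univ_two, Matrix.cons_val_zero, Matrix.cons_val_one, norm_neg, norm_one,
    mul_one, ← sq] at h
  rw [h, integral_comp_steinhausSum _ 0 (g := fun z => ‖z‖) (by fun_prop)]
  have hin : ∀ y : ℝ, ∫ x : ℝ, ‖Complex.exp (x * Complex.I) - Complex.exp (y * Complex.I)‖
      ∂angleMeasure = 4 / Real.pi := fun y => by
    rw [← integral_norm_exp_sub_one, ← integral_angleMeasure_add (φ := y)]
    · congr 1 with x
      push_cast
      rw [add_mul, Complex.exp_add, ← sub_one_mul, norm_mul, Complex.norm_exp_ofReal_mul_I, mul_one]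
    · intro x
      push_cast
      rw [add_mul, Complex.exp_add, Complex.exp_two_pi_mul_I, mul_one]
  have hS : ∀ θ : Fin 1 → ℝ, ∀ x : ℝ, ![(1 : ℂ), -1] 0 * Complex.exp (x * Complex.I) +
      steinhausSum (Fin.removeNth 0 ![(1 : ℂ), -1]) θ =
        Complex.exp (x * Complex.I) - Complex.exp (θ 0 * Complex.I) := fun θ x => by
    simp [steinhausSum, Fin.removeNth, sub_eq_add_neg]
  simp only [hS, hin]
  simp

theorem integrableOn_one_sub_besselZero_sq :
    IntegrableOn (fun t => (1 - besselZero t ^ 2) / t ^ 2) (Set.Ioi 0) := by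
  have h := integrableOn_one_sub_prod_besselZero ![(1 : ℂ), -1]
  simpa only [Fin.prod_univ_two, Matrix.cons_val_zero, Matrix.cons_val_one, norm_neg, norm_one,
    mul_one, ← sq] using h

/-! ### Gaussian integrals and their numerical evaluation. -/

/-- Taylor polynomial of `y ↦ exp (-y)` with `n` terms. -/
noncomputable def expNegTaylor (n : ℕ) (y : ℝ) : ℝ :=
  ∑ k ∈ Finset.range n, (-1) ^ k * y ^ k / k.factorial

theorem hasDerivAt_expNegTaylor (n : ℕ) (y : ℝ) :
    HasDerivAt (expNegTaylor (n + 1)) (-expNegTaylor n y) y := by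
  have hfun : expNegTaylor (n + 1) = fun y => ∑ k ∈ Finset.range n,
      (-1 : ℝ) ^ (k + 1) * y ^ (k + 1) / (k + 1).factorial + 1 := by
    funext y
    simp [expNegTaylor, Finset.sum_range_succ']
  rw [hfun, expNegTaylor, ← Finset.sum_neg_distrib]
  refine HasDerivAt.add_const _ (HasDerivAt.fun_sum fun k _ => ?_)
  have := ((hasDerivAt_pow (k + 1) y).const_mul ((-1 : ℝ) ^ (k + 1))).div_const
    ((k + 1).factorial : ℝ)
  refine this.congr_deriv ?_
  rw [Nat.factorial_succ k]
  have : (k.factorial : ℝ) ≠ 0 := by positivity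
  push_cast
  have h2 : ((k : ℝ) + 1) ≠ 0 := by positivity
  field_simp
  ring

theorem expNegTaylor_alternates (n : ℕ) {y : ℝ} (hy : 0 ≤ y) :
    0 ≤ (-1) ^ n * (Real.exp (-y) - expNegTaylor n y) := by
  induction n generalizing y with
  | zero => simp [expNegTaylor, Real.exp_nonneg]
  | succ n ih =>
    refine nonneg_of_hasDerivAt_nonneg
      (f := fun y => (-1) ^ (n + 1) * (Real.exp (-y) - expNegTaylor (n + 1) y))
      (by simp [expNegTaylor, Finset.sum_range_succ'])
      (fun y => (((hasDerivAt_neg y).exp).sub (hasDerivAt_expNegTaylor n y)).const_mul _)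
      (fun y hy => ?_) hy
    have := ih hy
    rw [pow_succ]
    linarith

section Gaussian

/-- A primitive of `u ↦ (1 - exp (-c u²)) / u²`. -/
noncomputable def gaussPrimitive (c u : ℝ) : ℝ :=
  2 * c * (∫ v in (0 : ℝ)..u, Real.exp (-c * v ^ 2)) - (1 - Real.exp (-c * u ^ 2)) / u

/-- The quotient 0/0 takes the value 0, which is also the limit at 0; hence the primitive is
continuous up to the endpoint. -/
theorem gaussPrimitive_zero (c : ℝ) : gaussPrimitive c 0 = 0 := by simp [gaussPrimitive]

theorem hasDerivAt_gaussPrimitive (c : ℝ) {u : ℝ} (hu : 0 < u) :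
    HasDerivAt (gaussPrimitive c) ((1 - Real.exp (-c * u ^ 2)) / u ^ 2) u := by
  have hc : Continuous fun v : ℝ => Real.exp (-c * v ^ 2) := by fun_prop
  have h1 : HasDerivAt (fun u => ∫ v in (0 : ℝ)..u, Real.exp (-c * v ^ 2))
      (Real.exp (-c * u ^ 2)) u := hc.integral_hasStrictDerivAt 0 u |>.hasDerivAt
  have h2 : HasDerivAt (fun u : ℝ => 1 - Real.exp (-c * u ^ 2))
      (-(Real.exp (-c * u ^ 2) * (-c * (2 * u)))) u := by
    have := (((hasDerivAt_pow 2 u).const_mul (-c)).exp).const_sub 1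
    simpa using this
  refine ((h1.const_mul (2 * c)).sub (h2.div (hasDerivAt_id u) hu.ne')).congr_deriv ?_
  simp only [id]
  field_simp
  ring

theorem one_sub_exp_bounds {c : ℝ} (hc : 0 ≤ c) (u : ℝ) :
    0 ≤ 1 - Real.exp (-c * u ^ 2) ∧ 1 - Real.exp (-c * u ^ 2) ≤ c * u ^ 2 := by
  have h1 := Real.add_one_le_exp (-c * u ^ 2)
  have h2 : Real.exp (-c * u ^ 2) ≤ 1 :=
    Real.exp_le_one_iff.2 (by nlinarith [mul_nonneg hc (sq_nonneg u)])
  constructor <;> linarith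

theorem continuousWithinAt_gaussPrimitive_zero {c : ℝ} (hc : 0 ≤ c) :
    ContinuousWithinAt (gaussPrimitive c) (Set.Ici 0) 0 := by
  have hcont : Continuous fun v : ℝ => Real.exp (-c * v ^ 2) := by fun_prop
  have h1 : Continuous fun u => 2 * c * ∫ v in (0 : ℝ)..u, Real.exp (-c * v ^ 2) :=
    continuous_const.mul (intervalIntegral.continuous_primitive
      (fun _ _ => hcont.intervalIntegrable _ _) 0)
  refine h1.continuousWithinAt.sub (ContinuousAt.continuousWithinAt ?_)
  rw [ContinuousAt, div_zero]
  have hlim : Filter.Tendsto (fun u : ℝ => c * |u|) (nhds 0) (nhds 0) := by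
    have : Continuous fun u : ℝ => c * |u| := by fun_prop
    simpa using this.tendsto 0
  refine squeeze_zero_norm (fun u => ?_) hlim
  rw [norm_div, Real.norm_eq_abs, Real.norm_eq_abs]
  have hb := one_sub_exp_bounds hc u
  rw [abs_of_nonneg hb.1]
  by_cases hu : u = 0
  · simp [hu]
  · rw [div_le_iff₀ (abs_pos.2 hu), mul_assoc, abs_mul_abs_self]
    simpa [sq] using hb.2

theorem tendsto_gaussPrimitive {c : ℝ} (hc : 0 < c) :
    Filter.Tendsto (gaussPrimitive c) Filter.atTop (nhds (√(Real.pi * c))) := by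
  have h1 : Filter.Tendsto (fun u => ∫ v in (0 : ℝ)..u, Real.exp (-c * v ^ 2)) Filter.atTop
      (nhds (√(Real.pi / c) / 2)) := by
    rw [← integral_gaussian_Ioi]
    exact intervalIntegral_tendsto_integral_Ioi 0 (integrable_exp_neg_mul_sq hc).integrableOn
      Filter.tendsto_id
  have h2 : Filter.Tendsto (fun u : ℝ => (1 - Real.exp (-c * u ^ 2)) / u) Filter.atTop
      (nhds 0) := by
    refine squeeze_zero' (Filter.eventually_gt_atTop 0 |>.mono fun u hu => ?_)
      (Filter.eventually_gt_atTop 0 |>.mono fun u hu => ?_) tendsto_inv_atTop_zero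
    · exact div_nonneg (one_sub_exp_bounds hc.le u).1 hu.le
    · rw [inv_eq_one_div]
      gcongr
      linarith [Real.exp_pos (-c * u ^ 2)]
  have h3 := (h1.const_mul (2 * c)).sub h2
  have e : 2 * c * (√(Real.pi / c) / 2) - 0 = √(Real.pi * c) := by
    have : Real.pi * c = c ^ 2 * (Real.pi / c) := by field_simp
    rw [this, Real.sqrt_mul (sq_nonneg c), Real.sqrt_sq hc.le]
    ring
  rw [e] at h3
  exact h3

theorem integrableOn_one_sub_exp_div_sq {c : ℝ} (hc : 0 < c) :
    IntegrableOn (fun u : ℝ => (1 - Real.exp (-c * u ^ 2)) / u ^ 2) (Set.Ioi 0) :=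
  integrableOn_Ioi_deriv_of_nonneg (continuousWithinAt_gaussPrimitive_zero hc.le)
    (fun _ hu => hasDerivAt_gaussPrimitive c hu)
    (fun u _ => div_nonneg (one_sub_exp_bounds hc.le u).1 (sq_nonneg u))
    (tendsto_gaussPrimitive hc)

theorem integral_one_sub_exp_div_sq {c : ℝ} (hc : 0 < c) :
    ∫ u in Set.Ioi (0 : ℝ), (1 - Real.exp (-c * u ^ 2)) / u ^ 2 = √(Real.pi * c) := by
  rw [integral_Ioi_of_hasDerivAt_of_tendsto (continuousWithinAt_gaussPrimitive_zero hc.le)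
    (fun _ hu => hasDerivAt_gaussPrimitive c hu) (integrableOn_one_sub_exp_div_sq hc)
    (tendsto_gaussPrimitive hc), gaussPrimitive_zero, sub_zero]

theorem integral_Ioc_one_sub_exp_div_sq {c T : ℝ} (hc : 0 < c) (hT : 0 < T) :
    ∫ u in Set.Ioc 0 T, (1 - Real.exp (-c * u ^ 2)) / u ^ 2 = gaussPrimitive c T := by
  rw [← intervalIntegral.integral_of_le hT.le,
    intervalIntegral.integral_eq_sub_of_hasDerivAt_of_le hT.le (f := gaussPrimitive c),
    gaussPrimitive_zero, sub_zero]
  · intro u hu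
    rcases hu.1.eq_or_lt with rfl | h0
    · exact (continuousWithinAt_gaussPrimitive_zero hc.le).mono Set.Icc_subset_Ici_self
    · exact (hasDerivAt_gaussPrimitive c h0).continuousAt.continuousWithinAt
  · exact fun u hu => hasDerivAt_gaussPrimitive c hu.1
  · rw [intervalIntegrable_iff_integrableOn_Ioc_of_le hT.le]
    exact (integrableOn_one_sub_exp_div_sq hc).mono_set Set.Ioc_subset_Ioi_self

/-- The truncated Gaussian integrand. -/
noncomputable def truncGauss (T u : ℝ) : ℝ :=
  if u ≤ T then Real.exp (-(1 / 2) * u ^ 2) else 0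

/-- The tail contributes 1/T, which cancels the -1/T in the boundary term of `gaussPrimitive`. -/
theorem integral_one_sub_truncGauss {T : ℝ} (hT : 0 < T) :
    IntegrableOn (fun u => (1 - truncGauss T u) / u ^ 2) (Set.Ioi 0) ∧
    ∫ u in Set.Ioi (0 : ℝ), (1 - truncGauss T u) / u ^ 2 =
      (∫ v in (0 : ℝ)..T, Real.exp (-(1 / 2) * v ^ 2)) + Real.exp (-(1 / 2) * T ^ 2) / T := by
  have hU : Set.Ioi (0 : ℝ) = Set.Ioc 0 T ∪ Set.Ioi T := (Set.Ioc_union_Ioi_eq_Ioi hT.le).symm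
  have hd : Disjoint (Set.Ioc 0 T) (Set.Ioi T) := by
    rw [Set.disjoint_left]
    exact fun u hu hu' => absurd hu.2 (not_le.2 hu')
  have e1 : Set.EqOn (fun u => (1 - Real.exp (-(1 / 2) * u ^ 2)) / u ^ 2)
      (fun u => (1 - truncGauss T u) / u ^ 2) (Set.Ioc 0 T) := fun u hu => by
    simp only [truncGauss, if_pos hu.2]
  have e2 : Set.EqOn (fun u : ℝ => u ^ (-2 : ℝ)) (fun u => (1 - truncGauss T u) / u ^ 2)
      (Set.Ioi T) := fun u hu => by
    have hu0 : 0 < u := hT.trans hu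
    have hn : ¬u ≤ T := not_le.2 hu
    simp only [truncGauss, if_neg hn, sub_zero]
    rw [Real.rpow_neg hu0.le, one_div]
    norm_cast
  have i1 : IntegrableOn (fun u => (1 - truncGauss T u) / u ^ 2) (Set.Ioc 0 T) :=
    ((integrableOn_one_sub_exp_div_sq (by norm_num : (0 : ℝ) < 1 / 2)).mono_set
      Set.Ioc_subset_Ioi_self).congr_fun e1 measurableSet_Ioc
  have i2 : IntegrableOn (fun u => (1 - truncGauss T u) / u ^ 2) (Set.Ioi T) :=
    (integrableOn_Ioi_rpow_of_lt (by norm_num) hT).congr_fun e2 measurableSet_Ioi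
  refine ⟨by rw [hU]; exact i1.union i2, ?_⟩
  rw [hU, setIntegral_union hd measurableSet_Ioi i1 i2, ← setIntegral_congr_fun measurableSet_Ioc e1,
    ← setIntegral_congr_fun measurableSet_Ioi e2, integral_Ioi_rpow_of_lt (by norm_num) hT,
    integral_Ioc_one_sub_exp_div_sq (by norm_num) hT, gaussPrimitive]
  norm_num [Real.rpow_neg_one]
  field_simp
  ring

end Gaussian

/-- The target 1.2715 is just below 4/π = 1.2732…. An odd number of Taylor terms makes the
polynomial an upper bound for the exponential. -/
theorem integral_exp_neg_sq_half_le :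
    (∫ v in (0 : ℝ)..(93 / 50), Real.exp (-(1 / 2) * v ^ 2)) +
      Real.exp (-(1 / 2) * (93 / 50) ^ 2) / (93 / 50) ≤ 1.2715 := by
  have hexp : ∀ v : ℝ, Real.exp (-(1 / 2) * v ^ 2) ≤ expNegTaylor 9 (v ^ 2 / 2) := fun v => by
    have := expNegTaylor_alternates 9 (y := v ^ 2 / 2) (by positivity)
    rw [show -(1 / 2) * v ^ 2 = -(v ^ 2 / 2) by ring]
    norm_num at this
    exact this
  have hpoly : ∫ v in (0 : ℝ)..(93 / 50), expNegTaylor 9 (v ^ 2 / 2) =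
      ∑ k ∈ Finset.range 9, (-1 : ℝ) ^ k / 2 ^ k / k.factorial *
        ((93 / 50) ^ (2 * k + 1) / (2 * k + 1)) := by
    unfold expNegTaylor
    rw [intervalIntegral.integral_finsetSum
      fun k _ => Continuous.intervalIntegrable (by fun_prop) _ _]
    refine Finset.sum_congr rfl fun k _ => ?_
    have e : ∀ v : ℝ, (-1) ^ k * (v ^ 2 / 2) ^ k / k.factorial =
        (-1) ^ k / 2 ^ k / k.factorial * v ^ (2 * k) := fun v => by
      rw [div_pow, ← pow_mul]
      ring
    simp only [e]
    rw [intervalIntegral.integral_const_mul, integral_pow]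
    simp
  have hint : (∫ v in (0 : ℝ)..(93 / 50), Real.exp (-(1 / 2) * v ^ 2)) ≤
      ∫ v in (0 : ℝ)..(93 / 50), expNegTaylor 9 (v ^ 2 / 2) := by
    refine intervalIntegral.integral_mono_on (by norm_num)
      (Continuous.intervalIntegrable (by fun_prop) _ _)
      (Continuous.intervalIntegrable (by unfold expNegTaylor; fun_prop) _ _) fun v _ => hexp v
  have h2 := hexp (93 / 50)
  rw [hpoly] at hint
  norm_num [expNegTaylor, Finset.sum_range_succ, Nat.factorial] at hint h2 ⊢
  linarith

/-! ### Khinchine's inequality for small coefficients: comparing |J₀|^s with a Gaussian. -/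

theorem le_exp_of_le {u : ℝ} (h0 : 0 ≤ u) (hu : u ≤ 93 / 50) :
    21 / 50 ≤ Real.exp (-(u ^ 2 / 4)) := by
  have h1 : Real.exp (-(8649 / 10000)) ≤ Real.exp (-(u ^ 2 / 4)) := by
    refine Real.exp_le_exp.2 (neg_le_neg ?_)
    nlinarith
  have h2 := expNegTaylor_alternates 6 (y := 8649 / 10000) (by norm_num)
  norm_num [expNegTaylor, Finset.sum_range_succ, Nat.factorial] at h2
  linarith

/-- The integrand comparing `|J₀|^s` with the corresponding Gaussian. -/
noncomputable def besselGap (s u : ℝ) : ℝ :=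
  (Real.exp (-(s / 4) * u ^ 2) - |besselZero u| ^ s) / u ^ 2

/-- Let f = exp(-u²/4), g = |J₀(u)| and q = 21/50. Up to 93/50 one has g ≤ f and q ≤ f, so f^s - g^s
≥ f^(s-2) (f² - g²) ≥ q^(s-2) (f² - g²). Beyond it g ≤ q, and f^s - g^s ≥ -q^(s-2) g². The Gaussian
is dropped there, whence `truncGauss`; a single factor q^(s-2) serves both ranges and reduces
everything to s = 2. -/
theorem besselGap_ge {s u : ℝ} (hs : 2 ≤ s) (hu : 0 < u) :
    (21 / 50 : ℝ) ^ (s - 2) *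
      ((1 - besselZero u ^ 2) / u ^ 2 - (1 - truncGauss (93 / 50) u) / u ^ 2) ≤ besselGap s u := by
  have hg0 : 0 ≤ |besselZero u| := abs_nonneg _
  have hgs : |besselZero u| ^ s = |besselZero u| ^ (s - 2) * besselZero u ^ 2 := by
    rw [← sq_abs, ← Real.rpow_natCast, ← Real.rpow_add_of_nonneg hg0 (by linarith) (by norm_num)]
    norm_num
  rw [besselGap, ← sub_div, mul_div_assoc']
  gcongr
  rw [hgs]
  have hsq : 0 ≤ besselZero u ^ 2 := sq_nonneg _
  by_cases h : u ≤ 93 / 50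
  · set f := Real.exp (-(u ^ 2 / 4)) with hf
    have hf2 : Real.exp (-(1 / 2) * u ^ 2) = f ^ 2 := by
      rw [hf, ← Real.exp_nat_mul]
      congr 1
      push_cast
      ring
    have hfs : Real.exp (-(s / 4) * u ^ 2) = f ^ (s - 2) * f ^ 2 := by
      rw [hf, ← Real.exp_nat_mul, ← Real.exp_mul, ← Real.exp_add]
      congr 1
      push_cast
      ring
    have hgf := abs_besselZero_le_exp hu.le h
    have h1 : |besselZero u| ^ (s - 2) ≤ f ^ (s - 2) :=
      Real.rpow_le_rpow hg0 hgf (by linarith)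
    have h2 : (21 / 50 : ℝ) ^ (s - 2) ≤ f ^ (s - 2) :=
      Real.rpow_le_rpow (by norm_num) (le_exp_of_le hu.le h) (by linarith)
    have h3 : besselZero u ^ 2 ≤ f ^ 2 := by
      rw [← sq_abs]
      gcongr
    rw [truncGauss, if_pos h, hf2, hfs]
    nlinarith [mul_nonneg (sub_nonneg.2 h1) hsq, mul_nonneg (sub_nonneg.2 h2) (sub_nonneg.2 h3)]
  · have h1 : |besselZero u| ^ (s - 2) ≤ (21 / 50 : ℝ) ^ (s - 2) :=
      Real.rpow_le_rpow hg0 (abs_besselZero_le (not_le.1 h).le) (by linarith)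
    rw [truncGauss, if_neg h]
    nlinarith [mul_nonneg (sub_nonneg.2 h1) hsq, Real.exp_pos (-(s / 4) * u ^ 2)]

theorem integrableOn_besselGap {s : ℝ} (hs : 1 ≤ s) : IntegrableOn (besselGap s) (Set.Ioi 0) := by
  have hJ : IntegrableOn (fun u => (1 - |besselZero u| ^ s) / u ^ 2) (Set.Ioi 0) := by
    have hc := continuous_besselZero
    refine Integrable.mono' (integrableOn_one_sub_besselZero_sq.const_mul s) ?_
      (ae_of_all _ fun u => ?_)
    · have : Continuous fun u => |besselZero u| ^ s := hc.abs.rpow_const fun _ => Or.inr (by linarith)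
      exact Measurable.aestronglyMeasurable (by fun_prop)
    · have h1 := abs_besselZero_le_one u
      have h0 := abs_nonneg (besselZero u)
      have hle : |besselZero u| ^ s ≤ 1 := Real.rpow_le_one h0 h1 (by linarith)
      -- Bernoulli: 1 - g^s ≤ s (1 - g) ≤ s (1 - g²) for 0 ≤ g ≤ 1, so the case s = 2 dominates.
      have hb := one_add_mul_self_le_rpow_one_add (s := |besselZero u| - 1) (by linarith) hs
      rw [add_sub_cancel] at hb
      rw [Real.norm_of_nonneg (div_nonneg (by linarith) (sq_nonneg u)), mul_div_assoc']
      gcongr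
      rw [← sq_abs (besselZero u)]
      nlinarith [mul_nonneg h0 (sub_nonneg.2 h1)]
  refine (hJ.sub (integrableOn_one_sub_exp_div_sq (by linarith : 0 < s / 4))).congr
    (ae_of_all _ fun u => ?_)
  simp only [Pi.sub_apply, besselGap]
  ring

/-- After `besselGap_ge`, only the numerical comparison 1.2715 ≤ 4/π is left. -/
theorem integral_besselGap_nonneg {s : ℝ} (hs : 2 ≤ s) :
    0 ≤ ∫ u in Set.Ioi (0 : ℝ), besselGap s u := by
  have hT : (0 : ℝ) < 93 / 50 := by norm_num
  obtain ⟨hi, hI⟩ := integral_one_sub_truncGauss hT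
  have hm := setIntegral_mono_on ((integrableOn_one_sub_besselZero_sq.sub hi).const_mul
    ((21 / 50 : ℝ) ^ (s - 2))) (integrableOn_besselGap (by linarith)) measurableSet_Ioi
    fun u hu => besselGap_ge hs hu
  refine le_trans ?_ hm
  rw [integral_const_mul]
  refine mul_nonneg (by positivity) ?_
  have hsub := integral_sub integrableOn_one_sub_besselZero_sq hi
  simp only [Pi.sub_apply]
  rw [hsub, integral_one_sub_besselZero_sq, hI, sub_nonneg]
  refine integral_exp_neg_sq_half_le.trans ?_
  rw [le_div_iff₀ Real.pi_pos]
  nlinarith [Real.pi_lt_d4]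

theorem prod_besselZero_le {n : ℕ} {r : Fin n → ℝ} (hr : ∀ j, 0 ≤ r j)
    (hsum : ∑ j, r j ^ 2 = 1) (t : ℝ) :
    ∏ j, besselZero (t * r j) ≤ ∑ j, r j ^ 2 * |besselZero (t * r j)| ^ (1 / r j ^ 2) := by
  have h := Real.geom_mean_le_arith_mean_weighted Finset.univ (fun j => r j ^ 2)
    (fun j => |besselZero (t * r j)| ^ (1 / r j ^ 2)) (fun j _ => sq_nonneg _) hsum
    (fun j _ => by positivity)
  refine le_trans ?_ h
  refine (le_abs_self _).trans_eq ?_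
  rw [Finset.abs_prod]
  refine Finset.prod_congr rfl fun j _ => ?_
  rcases (hr j).eq_or_lt with h0 | h0
  -- For r j = 0 the exponent 1/0 is read as 0; both sides are 1 because J₀(0) = 1.
  · simp [← h0, besselZero_zero]
  · rw [← Real.rpow_mul (abs_nonneg _), one_div, inv_mul_cancel₀ (by positivity), Real.rpow_one]

/-- Both sides are integrals against dt/t². AM-GM bounds their difference below by a combination of
integrals of `besselGap` with s = 1/‖a j‖², each rescaled by u = ‖a j‖ t. The smallness assumption
is exactly s ≥ 2. -/
theorem sqrt_le_integral_norm_steinhausSum_of_small {n : ℕ} {a : Fin n → ℂ}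
    (ha : ∑ j, ‖a j‖ ^ 2 = 1) (hsmall : ∀ j, ‖a j‖ ^ 2 ≤ 1 / 2) :
    √(Real.pi * (1 / 4)) ≤ ∫ θ, ‖steinhausSum a θ‖ ∂angles n := by
  rw [← integral_one_sub_exp_div_sq (by norm_num), ← integral_one_sub_prod_besselZero, ← sub_nonneg,
    ← integral_sub (integrableOn_one_sub_prod_besselZero a)
    (integrableOn_one_sub_exp_div_sq (by norm_num))]
  -- the summands of the lower bound given by the weighted AM-GM inequality
  have hgap : ∀ j, ∀ t : ℝ, ‖a j‖ ^ 2 * ((Real.exp (-(1 / 4) * t ^ 2) -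
      |besselZero (t * ‖a j‖)| ^ (1 / ‖a j‖ ^ 2)) / t ^ 2) =
        ‖a j‖ ^ 4 * besselGap (1 / ‖a j‖ ^ 2) (‖a j‖ * t) := fun j t => by
    by_cases h0 : ‖a j‖ = 0
    · simp [h0]
    · rw [besselGap, mul_comm t, show -(1 / ‖a j‖ ^ 2 / 4) * (‖a j‖ * t) ^ 2 = -(1 / 4) * t ^ 2 by
        field_simp]
      field_simp
  have hs : ∀ j, ‖a j‖ ≠ 0 → 2 ≤ 1 / ‖a j‖ ^ 2 := fun j h0 => by
    rw [le_div_iff₀ (by positivity)]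
    linarith [hsmall j]
  have hs1 : ∀ j, ‖a j‖ ≠ 0 → 1 ≤ 1 / ‖a j‖ ^ 2 := fun j h0 => one_le_two.trans (hs j h0)
  have hint : ∀ j, IntegrableOn
      (fun t => ‖a j‖ ^ 4 * besselGap (1 / ‖a j‖ ^ 2) (‖a j‖ * t)) (Set.Ioi 0) := fun j => by
    by_cases h0 : ‖a j‖ = 0
    · simp [h0]
    · refine Integrable.const_mul ?_ _
      have hp : 0 < ‖a j‖ := lt_of_le_of_ne (norm_nonneg _) (Ne.symm h0)
      exact (integrableOn_Ioi_comp_mul_left_iff (besselGap (1 / ‖a j‖ ^ 2)) 0 hp).2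
        (by simpa using integrableOn_besselGap (hs1 j h0))
  have hnn : ∀ j, 0 ≤ ∫ t in Set.Ioi (0 : ℝ),
      ‖a j‖ ^ 4 * besselGap (1 / ‖a j‖ ^ 2) (‖a j‖ * t) := fun j => by
    by_cases h0 : ‖a j‖ = 0
    · simp [h0]
    · have hp : 0 < ‖a j‖ := lt_of_le_of_ne (norm_nonneg _) (Ne.symm h0)
      rw [integral_const_mul, integral_comp_mul_left_Ioi _ 0 hp, mul_zero, smul_eq_mul]
      have := integral_besselGap_nonneg (hs j h0)
      positivity
  calc (0 : ℝ) ≤ ∑ j, ∫ t in Set.Ioi (0 : ℝ),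
        ‖a j‖ ^ 4 * besselGap (1 / ‖a j‖ ^ 2) (‖a j‖ * t) := Finset.sum_nonneg fun j _ => hnn j
    _ = ∫ t in Set.Ioi (0 : ℝ), ∑ j, ‖a j‖ ^ 4 * besselGap (1 / ‖a j‖ ^ 2) (‖a j‖ * t) :=
        (integral_finsetSum _ fun j _ => hint j).symm
    _ ≤ _ := by
        refine integral_mono (integrable_finsetSum _ fun j _ => hint j)
          ((integrableOn_one_sub_prod_besselZero a).sub
            (integrableOn_one_sub_exp_div_sq (by norm_num))) fun t => ?_
        have h := prod_besselZero_le (fun j => norm_nonneg (a j)) ha t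
        simp only [← hgap, mul_div_assoc', ← Finset.sum_div, ← sub_div]
        gcongr
        simp only [mul_sub, Finset.sum_sub_distrib, ← Finset.sum_mul, ha]
        linarith

/-- Khinchine's inequality for Steinhaus sums in `L¹`, with its best constant. -/
theorem sqrt_sum_sq_le_integral_norm_steinhausSum {n : ℕ} (a : Fin n → ℂ) :
    √(∑ j, ‖a j‖ ^ 2) ≤
      (4 / Real.pi) ^ (1 / 2 : ℝ) * ∫ θ, ‖steinhausSum a θ‖ ∂angles n := by
  set σ := √(∑ j, ‖a j‖ ^ 2) with hσ
  have hE : 0 ≤ ∫ θ, ‖steinhausSum a θ‖ ∂angles n := integral_nonneg fun _ => norm_nonneg _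
  rcases (Real.sqrt_nonneg (∑ j, ‖a j‖ ^ 2)).eq_or_lt with h0 | h0
  · rw [hσ, ← h0]
    positivity
  rw [← hσ] at h0
  have hσ2 : σ ^ 2 = ∑ j, ‖a j‖ ^ 2 := Real.sq_sqrt (by positivity)
  set b : Fin n → ℂ := fun j => a j / σ with hb
  have hbn : ∀ j, ‖b j‖ = ‖a j‖ / σ := fun j => by
    rw [hb, norm_div, Complex.norm_real, Real.norm_of_nonneg h0.le]
  have hb1 : ∑ j, ‖b j‖ ^ 2 = 1 := by
    simp only [hbn, div_pow, ← Finset.sum_div, ← hσ2]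
    exact div_self (by positivity)
  have hS : ∀ θ, ‖steinhausSum a θ‖ = σ * ‖steinhausSum b θ‖ := fun θ => by
    have hσc : (σ : ℂ) ≠ 0 := by exact_mod_cast h0.ne'
    have : steinhausSum a θ = σ * steinhausSum b θ := by
      simp only [steinhausSum, hb, Finset.mul_sum]
      exact Finset.sum_congr rfl fun j _ => by field_simp
    rw [this, norm_mul, Complex.norm_real, Real.norm_of_nonneg h0.le]
  have key : √(Real.pi * (1 / 4)) ≤ ∫ θ, ‖steinhausSum b θ‖ ∂angles n := by
    by_cases h : ∃ k, 1 / 2 ≤ ‖b k‖ ^ 2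
    · obtain ⟨k, hk⟩ := h
      refine le_trans (Real.sqrt_le_iff.2 ⟨by norm_num, ?_⟩)
        (le_integral_norm_steinhausSum_of_large hb1 hk)
      nlinarith [Real.pi_lt_d4]
    · push Not at h
      exact sqrt_le_integral_norm_steinhausSum_of_small hb1 fun j => (h j).le
  have hc : (4 / Real.pi) ^ (1 / 2 : ℝ) * √(Real.pi * (1 / 4)) = 1 := by
    rw [← Real.sqrt_eq_rpow, ← Real.sqrt_mul (by positivity), Real.sqrt_eq_one]
    field_simp
  simp only [hS]
  rw [integral_const_mul]
  calc σ = σ * ((4 / Real.pi) ^ (1 / 2 : ℝ) * √(Real.pi * (1 / 4))) := by rw [hc, mul_one]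
    _ ≤ σ * ((4 / Real.pi) ^ (1 / 2 : ℝ) * ∫ θ, ‖steinhausSum b θ‖ ∂angles n) := by gcongr
    _ = _ := by ring

/-! ### Vectors of c₀ and duality: random phases in the second variable. -/

namespace NullSeq

theorem norm_apply_le (x : NullSeq) (i : ℕ) : ‖x i‖ ≤ ‖x‖ :=
  BoundedContinuousFunction.norm_coe_le_norm (ZeroAtInftyContinuousMap.toBCF x) i

theorem norm_le {x : NullSeq} {C : ℝ} (hC : 0 ≤ C) : ‖x‖ ≤ C ↔ ∀ i, ‖x i‖ ≤ C :=
  BoundedContinuousFunction.norm_le (f := ZeroAtInftyContinuousMap.toBCF x) hC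

/-- Evaluation at an index, as a continuous linear functional. -/
noncomputable def eval (i : ℕ) : NullSeq →L[ℂ] ℂ :=
  LinearMap.mkContinuous
    { toFun := fun x => x i
      map_add' := fun _ _ => rfl
      map_smul' := fun _ _ => rfl } 1 fun x =>
      (norm_apply_le x i).trans_eq (one_mul _).symm

@[simp] theorem eval_apply (i : ℕ) (x : NullSeq) : eval i x = x i := rfl

theorem norm_eval_le (i : ℕ) : ‖eval i‖ ≤ 1 :=
  LinearMap.mkContinuous_norm_le _ zero_le_one _

theorem e_apply (k i : ℕ) : e k i = if i = k then 1 else 0 := by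
  change (Pi.single k (1 : ℂ) : ℕ → ℂ) i = _
  rw [Pi.single_apply]

theorem norm_sum_smul_e_le {n : ℕ} {y : Fin n → ℂ} (hy : ∀ j, ‖y j‖ ≤ 1) :
    ‖∑ j, y j • e j‖ ≤ 1 := by
  refine (norm_le zero_le_one).2 fun i => ?_
  rw [← eval_apply, map_sum]
  simp only [map_smul, eval_apply, e_apply, smul_eq_mul, mul_ite, mul_one, mul_zero]
  by_cases hi : i < n
  · rw [Finset.sum_eq_single ⟨i, hi⟩]
    · simpa using hy _
    · intro b _ hb
      rw [if_neg]
      rintro rfl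
      exact hb rfl
    · simp
  · rw [Finset.sum_eq_zero]
    · simp
    · intro b _
      rw [if_neg]
      rintro rfl
      exact hi b.2

end NullSeq

theorem exists_norm_le_one_mul_eq_norm (w : ℂ) : ∃ x : ℂ, ‖x‖ ≤ 1 ∧ x * w = ‖w‖ := by
  by_cases h : w = 0
  · exact ⟨0, by simp [h]⟩
  · refine ⟨star w / ‖w‖, ?_, ?_⟩
    · simp [h]
    · have h' : (‖w‖ : ℂ) ≠ 0 := by simpa using h
      rw [div_mul_eq_mul_div, div_eq_iff h', mul_comm, Complex.star_def, Complex.mul_conj,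
        Complex.normSq_eq_norm_sq]
      push_cast
      ring

/-- The vector x is chosen with the conjugate phases of the row sums, so that A(x, y) equals the
left side. -/
theorem sum_norm_le_opNorm (A : NullSeqBilinForm) (m : ℕ) {n : ℕ} {y : Fin n → ℂ}
    (hy : ∀ j, ‖y j‖ ≤ 1) :
    ∑ i : Fin m, ‖∑ j : Fin n, A (NullSeq.e i) (NullSeq.e j) * y j‖ ≤ ‖A‖ := by
  choose x hx hx' using fun i : Fin m =>
    exists_norm_le_one_mul_eq_norm (∑ j : Fin n, A (NullSeq.e i) (NullSeq.e j) * y j)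
  have h : A (∑ i, x i • NullSeq.e i) (∑ j, y j • NullSeq.e j) =
      ((∑ i : Fin m, ‖∑ j : Fin n, A (NullSeq.e i) (NullSeq.e j) * y j‖ : ℝ) : ℂ) := by
    push_cast
    rw [map_sum A, sum_apply]
    refine Finset.sum_congr rfl fun i _ => ?_
    rw [← hx' i, map_smul, smul_apply, map_sum, smul_eq_mul]
    congr 1
    refine Finset.sum_congr rfl fun j _ => ?_
    rw [map_smul, smul_eq_mul, mul_comm]
  have h2 := A.le_opNorm₂ (∑ i, x i • NullSeq.e i) (∑ j, y j • NullSeq.e j)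
  rw [h, Complex.norm_real, Real.norm_of_nonneg (by positivity)] at h2
  refine h2.trans ?_
  calc ‖A‖ * ‖∑ i, x i • NullSeq.e i‖ * ‖∑ j, y j • NullSeq.e j‖ ≤ ‖A‖ * 1 * 1 := by
        gcongr
        · exact NullSeq.norm_sum_smul_e_le hx
        · exact NullSeq.norm_sum_smul_e_le hy
    _ = ‖A‖ := by ring

/-- The coefficients of the `i`-th row of `A`, truncated to the first `n` columns. -/
noncomputable def rowCoeff (A : NullSeqBilinForm) (n i : ℕ) (j : Fin n) : ℂ :=
  A (NullSeq.e i) (NullSeq.e j)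

theorem sum_norm_steinhausSum_le (A : NullSeqBilinForm) (m : ℕ) {n : ℕ} (θ : Fin n → ℝ) :
    ∑ i : Fin m, ‖steinhausSum (rowCoeff A n i) θ‖ ≤ ‖A‖ :=
  sum_norm_le_opNorm A m fun j => (Complex.norm_exp_ofReal_mul_I (θ j)).le

theorem sum_integral_norm_steinhausSum_le (A : NullSeqBilinForm) (m n : ℕ) :
    ∑ i : Fin m, ∫ θ, ‖steinhausSum (rowCoeff A n i) θ‖ ∂angles n ≤ ‖A‖ := by
  have hint : ∀ i : Fin m, Integrable (fun θ => ‖steinhausSum (rowCoeff A n i) θ‖) (angles n) :=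
    fun i => integrable_comp_steinhausSum _ (g := fun z => ‖z‖) (by fun_prop)
  rw [← integral_finsetSum _ fun i _ => hint i]
  calc ∫ θ, ∑ i : Fin m, ‖steinhausSum (rowCoeff A n i) θ‖ ∂angles n
      ≤ ∫ _, ‖A‖ ∂angles n := by
        refine integral_mono (integrable_finsetSum _ fun i _ => hint i) (integrable_const _)
          fun θ => sum_norm_steinhausSum_le A m θ
    _ = ‖A‖ := by simp

/-! ### The bounds at the extreme exponents. -/

/-- The moduli of the matrix of `A`. -/
noncomputable def absMatrix (A : NullSeqBilinForm) (i j : ℕ) : ℝ≥0∞ :=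
  ‖A (NullSeq.e i) (NullSeq.e j)‖ₑ

theorem tsum_le_of_sum_fin_le {f : ℕ → ℝ≥0∞} {C : ℝ≥0∞} (h : ∀ m, ∑ i : Fin m, f i ≤ C) :
    ∑' i, f i ≤ C := by
  rw [ENNReal.tsum_eq_iSup_nat]
  exact iSup_le fun m => by simpa [Finset.sum_range] using h m

theorem mixedNorm_zero_zero_le (A : NullSeqBilinForm) :
    mixedNorm 0 0 (absMatrix A) ≤ ENNReal.ofReal ‖A‖ := by
  simp only [mixedNorm, recipNorm_zero]
  refine iSup_le fun i => iSup_le fun j => ?_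
  rw [absMatrix, ← ofReal_norm]
  gcongr
  refine (A.le_opNorm₂ _ _).trans ?_
  have he : ∀ k, ‖NullSeq.e k‖ ≤ 1 := fun k => (NullSeq.norm_le zero_le_one).2 fun i => by
    rw [NullSeq.e_apply]
    split_ifs <;> simp
  calc ‖A‖ * ‖NullSeq.e i‖ * ‖NullSeq.e j‖ ≤ ‖A‖ * 1 * 1 := by gcongr <;> exact he _
    _ = ‖A‖ := by ring

/-- Each coefficient of a row is at most the mean modulus of its Steinhaus sum. Finite truncations
suffice, since the suprema increase to their limits. -/
theorem mixedNorm_zero_one_le (A : NullSeqBilinForm) :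
    mixedNorm 0 1 (absMatrix A) ≤ ENNReal.ofReal ‖A‖ := by
  simp only [mixedNorm, recipNorm_zero, recipNorm_of_ne one_ne_zero, inv_one, ENNReal.rpow_one]
  refine tsum_le_of_sum_fin_le fun m => ?_
  have hlim : Filter.Tendsto (fun n : ℕ => ∑ i : Fin m, ⨆ j : Fin n, absMatrix A i j) Filter.atTop
      (nhds (∑ i : Fin m, ⨆ j, absMatrix A i j)) := by
    refine tendsto_finsetSum _ fun i _ => ?_
    have hmono : Monotone fun n : ℕ => ⨆ j : Fin n, absMatrix A i j := fun n n' h =>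
      iSup_le fun j => le_iSup (fun j : Fin n' => absMatrix A i j) (Fin.castLE h j)
    have : ⨆ j, absMatrix A i j = ⨆ n : ℕ, ⨆ j : Fin n, absMatrix A i j := by
      refine le_antisymm (iSup_le fun j => ?_) (iSup_le fun n => iSup_le fun j =>
        le_iSup (absMatrix A i) _)
      exact le_iSup_of_le (j + 1) (le_iSup (fun j : Fin (_ + 1) => absMatrix A i j) (Fin.last j))
    rw [this]
    exact tendsto_atTop_iSup hmono
  refine le_of_tendsto' hlim fun n => ?_
  refine le_trans ?_ (ENNReal.ofReal_le_ofReal (sum_integral_norm_steinhausSum_le A m n))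
  rw [ENNReal.ofReal_sum_of_nonneg fun i _ => by positivity]
  refine Finset.sum_le_sum fun i _ => iSup_le fun j => ?_
  rw [absMatrix, ← ofReal_norm]
  exact ENNReal.ofReal_le_ofReal (norm_le_integral_norm_steinhausSum (rowCoeff A n i) j)

theorem enorm_rpow_two_eq (z : ℂ) : ‖z‖ₑ ^ (2 : ℝ) = ENNReal.ofReal (‖z‖ ^ 2) := by
  rw [← ofReal_norm, ENNReal.ofReal_rpow_of_nonneg (norm_nonneg _) (by norm_num)]
  norm_cast

/-- By orthogonality ∑ |a_ij|² = E ∑ |S_i|² ≤ E (∑ |S_i|)² ≤ ‖A‖². -/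
theorem mixedNorm_half_half_le (A : NullSeqBilinForm) :
    mixedNorm (1 / 2) (1 / 2) (absMatrix A) ≤ ENNReal.ofReal ‖A‖ := by
  have h2 : (1 / 2 : ℝ) ≠ 0 := by norm_num
  simp only [mixedNorm, recipNorm_of_ne h2]
  simp only [← ENNReal.rpow_mul, show (1 / 2 : ℝ)⁻¹ = 2 by norm_num,
    show (1 / 2 : ℝ) * 2 = 1 by norm_num, ENNReal.rpow_one]
  rw [one_div, ENNReal.rpow_inv_le_iff (by norm_num)]
  refine tsum_le_of_sum_fin_le fun m => ?_
  have hlim : Filter.Tendsto (fun n : ℕ => ∑ i : Fin m, ∑ j : Fin n, absMatrix A i j ^ (2 : ℝ))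
      Filter.atTop (nhds (∑ i : Fin m, ∑' j, absMatrix A i j ^ (2 : ℝ))) := by
    refine tendsto_finsetSum _ fun i _ => ?_
    simp only [← Finset.sum_range fun j => absMatrix A i j ^ (2 : ℝ)]
    exact ENNReal.tendsto_nat_tsum _
  refine le_of_tendsto' hlim fun n => ?_
  rw [ENNReal.ofReal_rpow_of_nonneg (norm_nonneg A) (by norm_num)]
  calc ∑ i : Fin m, ∑ j : Fin n, absMatrix A i j ^ (2 : ℝ)
      = ENNReal.ofReal (∑ i : Fin m, ∑ j : Fin n, ‖rowCoeff A n i j‖ ^ 2) := by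
        rw [ENNReal.ofReal_sum_of_nonneg fun i _ => by positivity]
        refine Finset.sum_congr rfl fun i _ => ?_
        rw [ENNReal.ofReal_sum_of_nonneg fun i _ => by positivity]
        exact Finset.sum_congr rfl fun j _ => enorm_rpow_two_eq _
    _ ≤ ENNReal.ofReal (‖A‖ ^ (2 : ℝ)) := by
        refine ENNReal.ofReal_le_ofReal ?_
        have hint : ∀ i : Fin m,
            Integrable (fun θ => ‖steinhausSum (rowCoeff A n i) θ‖ ^ 2) (angles n) :=
          fun i => integrable_comp_steinhausSum _ (g := fun z => ‖z‖ ^ 2) (by fun_prop)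
        simp only [← integral_norm_steinhausSum_sq]
        rw [← integral_finsetSum _ fun i _ => hint i]
        calc ∫ θ, ∑ i : Fin m, ‖steinhausSum (rowCoeff A n i) θ‖ ^ 2 ∂angles n
            ≤ ∫ _, ‖A‖ ^ 2 ∂angles n := by
              refine integral_mono (integrable_finsetSum _ fun i _ => hint i)
                (integrable_const _) fun θ => ?_
              refine (Finset.sum_sq_le_sq_sum_of_nonneg fun i _ => norm_nonneg _).trans ?_
              gcongr
              exact sum_norm_steinhausSum_le A m θ
          _ = ‖A‖ ^ (2 : ℝ) := by simp

/-- The only place where Khinchine's inequality enters; it is applied row by row. -/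
theorem mixedNorm_half_one_le (A : NullSeqBilinForm) :
    mixedNorm (1 / 2) 1 (absMatrix A) ≤ ENNReal.ofReal ((4 / Real.pi) ^ (1 / 2 : ℝ) * ‖A‖) := by
  have h2 : (1 / 2 : ℝ) ≠ 0 := by norm_num
  simp only [mixedNorm, recipNorm_of_ne h2, recipNorm_of_ne one_ne_zero, inv_one, ENNReal.rpow_one,
    show (1 / 2 : ℝ)⁻¹ = 2 by norm_num]
  refine tsum_le_of_sum_fin_le fun m => ?_
  have hlim : Filter.Tendsto
      (fun n : ℕ => ∑ i : Fin m, (∑ j : Fin n, absMatrix A i j ^ (2 : ℝ)) ^ (1 / 2 : ℝ))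
      Filter.atTop (nhds (∑ i : Fin m, (∑' j, absMatrix A i j ^ (2 : ℝ)) ^ (1 / 2 : ℝ))) := by
    refine tendsto_finsetSum _ fun i _ => ?_
    simp only [← Finset.sum_range fun j => absMatrix A i j ^ (2 : ℝ)]
    exact (ENNReal.continuous_rpow_const.tendsto _).comp (ENNReal.tendsto_nat_tsum _)
  refine le_of_tendsto' hlim fun n => ?_
  calc ∑ i : Fin m, (∑ j : Fin n, absMatrix A i j ^ (2 : ℝ)) ^ (1 / 2 : ℝ)
      = ENNReal.ofReal (∑ i : Fin m, √(∑ j : Fin n, ‖rowCoeff A n i j‖ ^ 2)) := by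
        rw [ENNReal.ofReal_sum_of_nonneg fun i _ => by positivity]
        refine Finset.sum_congr rfl fun i _ => ?_
        rw [Real.sqrt_eq_rpow, ← ENNReal.ofReal_rpow_of_nonneg (by positivity) (by norm_num),
          ENNReal.ofReal_sum_of_nonneg fun i _ => by positivity]
        congr 1
        exact Finset.sum_congr rfl fun j _ => enorm_rpow_two_eq _
    _ ≤ _ := by
        refine ENNReal.ofReal_le_ofReal ?_
        calc ∑ i : Fin m, √(∑ j : Fin n, ‖rowCoeff A n i j‖ ^ 2)
            ≤ ∑ i : Fin m, (4 / Real.pi) ^ (1 / 2 : ℝ) *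
                ∫ θ, ‖steinhausSum (rowCoeff A n i) θ‖ ∂angles n :=
              Finset.sum_le_sum fun i _ => sqrt_sum_sq_le_integral_norm_steinhausSum _
          _ ≤ _ := by
              rw [← Finset.mul_sum]
              gcongr
              exact sum_integral_norm_steinhausSum_le A m n

theorem mixedNorm_one_half_le (A : NullSeqBilinForm) :
    mixedNorm 1 (1 / 2) (absMatrix A) ≤ ENNReal.ofReal ((4 / Real.pi) ^ (1 / 2 : ℝ) * ‖A‖) := by
  refine (mixedNorm_swap_le (by norm_num) (by norm_num) _).trans ?_
  have := mixedNorm_half_one_le A.flip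
  rwa [ContinuousLinearMap.opNorm_flip] at this

/-! ### Interpolation between the extreme points. -/

/-- The mixed norms with exponents `1 / u`, `1 / v` of the matrix of `A` are at most
`(4 / π) ^ c * ‖A‖`. -/
def MixedBound (A : NullSeqBilinForm) (u v c : ℝ) : Prop :=
  mixedNorm u v (absMatrix A) ≤ ENNReal.ofReal ((4 / Real.pi) ^ c * ‖A‖)

theorem MixedBound.convex {A : NullSeqBilinForm} {u v c u' v' c' s t : ℝ} (h : MixedBound A u v c)
    (h' : MixedBound A u' v' c') (hu : 0 ≤ u) (hv : 0 ≤ v) (hu' : 0 ≤ u') (hv' : 0 ≤ v')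
    (hs : 0 ≤ s) (ht : 0 ≤ t) (hst : s + t = 1) :
    MixedBound A (s * u + t * u') (s * v + t * v') (s * c + t * c') := by
  rcases hs.eq_or_lt with rfl | hs
  · obtain rfl : t = 1 := by linarith
    simpa using h'
  rcases ht.eq_or_lt with rfl | ht
  · obtain rfl : s = 1 := by linarith
    simpa using h
  unfold MixedBound at *
  have hpi : 0 < 4 / Real.pi := by positivity
  refine (mixedNorm_convex hu hv hu' hv' hs ht hst _).trans ?_
  calc _ ≤ ENNReal.ofReal ((4 / Real.pi) ^ c * ‖A‖) ^ s *
        ENNReal.ofReal ((4 / Real.pi) ^ c' * ‖A‖) ^ t := by gcongr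
    _ = _ := by
      rw [ENNReal.ofReal_rpow_of_nonneg (by positivity) hs.le,
        ENNReal.ofReal_rpow_of_nonneg (by positivity) ht.le, ← ENNReal.ofReal_mul (by positivity),
        Real.mul_rpow (by positivity) (norm_nonneg A), Real.mul_rpow (by positivity)
        (norm_nonneg A), ← Real.rpow_mul hpi.le, ← Real.rpow_mul hpi.le]
      congr 1
      have e : ‖A‖ = ‖A‖ ^ s * ‖A‖ ^ t := by
        rw [← Real.rpow_add_of_nonneg (norm_nonneg A) hs.le ht.le, hst, Real.rpow_one]
      conv_rhs => rw [e, Real.rpow_add hpi, mul_comm s, mul_comm t]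
      ring

theorem mixedBound_of_add_le_one (A : NullSeqBilinForm) {u v : ℝ} (hu : 0 ≤ u) (huv : u ≤ v)
    (h : u + v ≤ 1) : MixedBound A u v 0 := by
  have h00 : MixedBound A 0 0 0 := by simpa [MixedBound] using mixedNorm_zero_zero_le A
  have h01 : MixedBound A 0 1 0 := by simpa [MixedBound] using mixedNorm_zero_one_le A
  have hhh : MixedBound A (1 / 2) (1 / 2) 0 := by
    simpa [MixedBound] using mixedNorm_half_half_le A
  rcases (show u ≤ 1 / 2 by linarith).eq_or_lt with rfl | hu2
  · obtain rfl : v = 1 / 2 := by linarith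
    exact hhh
  have hd : 0 < 1 - 2 * u := by linarith
  -- The line from (1/2, 1/2) through (u, v) meets the side u = 0 at (0, (v - u)/(1 - 2u)), which
  -- lies between (0,0) and (0,1).
  have h1 := h00.convex h01 le_rfl le_rfl le_rfl zero_le_one
    (s := (1 - u - v) / (1 - 2 * u)) (t := (v - u) / (1 - 2 * u))
    (div_nonneg (by linarith) hd.le) (div_nonneg (by linarith) hd.le)
    (by rw [← add_div, div_eq_one_iff_eq hd.ne']; ring)
  have hpos : 0 ≤ (v - u) / (1 - 2 * u) := div_nonneg (by linarith) hd.le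
  have h2 := h1.convex hhh (by simp) (by simpa using hpos) (by norm_num) (by norm_num)
    (s := 1 - 2 * u) (t := 2 * u) hd.le (by linarith) (by ring)
  convert h2 using 1
  · ring
  · linear_combination -(div_mul_cancel₀ (v - u) hd.ne')
  · ring

theorem mixedBound_of_one_le_add (A : NullSeqBilinForm) {u v : ℝ} (huv : u ≤ v)
    (hv1 : v ≤ 1) (h : 1 ≤ u + v) (h' : u + v ≤ 3 / 2) : MixedBound A u v (u + v - 1) := by
  have h01 : MixedBound A 0 1 0 := by simpa [MixedBound] using mixedNorm_zero_one_le A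
  have hhh : MixedBound A (1 / 2) (1 / 2) 0 := by
    simpa [MixedBound] using mixedNorm_half_half_le A
  have hh1 : MixedBound A (1 / 2) 1 (1 / 2) := mixedNorm_half_one_le A
  have h1h : MixedBound A 1 (1 / 2) (1 / 2) := mixedNorm_one_half_le A
  have hd : 0 < 2 - u - v := by linarith
  have hk : (v - u) / (2 - u - v) ≤ 1 := (div_le_one hd).2 (by linarith)
  have hk0 : 0 ≤ (v - u) / (2 - u - v) := div_nonneg (by linarith) hd.le
  -- The ratio k is constant on lines through (1, 1). The line through (u, v) meets u + v = 1 at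
  -- ((1-k)/2, (1+k)/2) and u + v = 3/2 at ((3-k)/4, (3+k)/4), the points of `hP` and `hQ`. The
  -- bound v ≤ 1 is what gives k ≤ 1.
  set k := (v - u) / (2 - u - v) with hkdef
  have hkd : k * (2 - u - v) = v - u := div_mul_cancel₀ _ hd.ne'
  have hP := h01.convex hhh le_rfl zero_le_one (by norm_num) (by norm_num)
    (s := k) (t := 1 - k) hk0 (by linarith) (by ring)
  have hQ := hh1.convex h1h (by norm_num) zero_le_one (by norm_num) (by norm_num)
    (s := (1 + k) / 2) (t := (1 - k) / 2) (by linarith) (by linarith) (by ring)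
  have h3 := hP.convex hQ (by linarith) (by linarith) (by linarith) (by linarith)
    (s := 3 - 2 * (u + v)) (t := 2 * (u + v - 1)) (by linarith) (by linarith) (by ring)
  convert h3 using 1
  · linear_combination hkd / 2
  · linear_combination -hkd / 2
  · ring

theorem mixedBound (A : NullSeqBilinForm) {u v : ℝ} (hu : 0 ≤ u) (huv : u ≤ v) (hv : v ≤ 1)
    (h : u + v ≤ 3 / 2) : MixedBound A u v (max 0 (u + v - 1)) := by
  rcases le_total (u + v) 1 with h1 | h1
  · rw [max_eq_left (by linarith)]
    exact mixedBound_of_add_le_one A hu huv h1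
  · rw [max_eq_right (by linarith)]
    exact mixedBound_of_one_le_add A huv hv h1 h

/-! ### From mixed bounds to optimal constants. -/

theorem mixedSum_eq_mixedNorm {a b : ℝ≥0∞} (ha : 1 ≤ a) (hb : 1 ≤ b) (A : NullSeqBilinForm) :
    mixedSum a b A = mixedNorm (a⁻¹).toReal (b⁻¹).toReal (absMatrix A) := by
  have ha' : a ≠ 0 := (zero_lt_one.trans_le ha).ne'
  have hb' : b ≠ 0 := (zero_lt_one.trans_le hb).ne'
  simp only [mixedSum, powerSum_eq_recipNorm ha', powerSum_eq_recipNorm hb', mixedNorm]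
  rfl

theorem mixedSum_swap_le {a b : ℝ≥0∞} (ha : 1 ≤ a) (hb : 1 ≤ b) (hab : b ≤ a)
    (A : NullSeqBilinForm) : mixedSum b a A ≤ mixedSum a b A.flip := by
  rw [mixedSum_eq_mixedNorm ha hb, mixedSum_eq_mixedNorm hb ha]
  refine mixedNorm_swap_le ENNReal.toReal_nonneg ?_ _
  have : b⁻¹ ≠ ∞ := by simpa using (zero_lt_one.trans_le hb).ne'
  exact ENNReal.toReal_mono this (by simpa using hab)

theorem IsLittlewoodConstant.swap {a b : ℝ≥0∞} {C : ℝ} (ha : 1 ≤ a) (hb : 1 ≤ b) (hab : b ≤ a)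
    (h : IsLittlewoodConstant a b C) : IsLittlewoodConstant b a C := fun A =>
  (mixedSum_swap_le ha hb hab A).trans ((h A.flip).trans_eq
    (by rw [ContinuousLinearMap.opNorm_flip]))

theorem toReal_inv_add_toReal_inv_le {a b : ℝ≥0∞} {c : ℝ} (ha : 1 ≤ a) (hb : 1 ≤ b)
    (h : a⁻¹ + b⁻¹ ≤ ENNReal.ofReal c) (hc : 0 ≤ c) : (a⁻¹).toReal + (b⁻¹).toReal ≤ c := by
  have ha' : a⁻¹ ≠ ∞ := by simpa using (zero_lt_one.trans_le ha).ne'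
  have hb' : b⁻¹ ≠ ∞ := by simpa using (zero_lt_one.trans_le hb).ne'
  rw [← ENNReal.toReal_add ha' hb']
  exact ENNReal.toReal_le_of_le_ofReal hc h

theorem isLittlewoodConstant_of_le {a b : ℝ≥0∞} (ha : 1 ≤ a) (hb : 1 ≤ b)
    (h : a⁻¹ + b⁻¹ ≤ 3 / 2) (hab : b ≤ a) :
    IsLittlewoodConstant a b
      ((4 / Real.pi) ^ max 0 ((a⁻¹).toReal + (b⁻¹).toReal - 1)) := fun A => by
  have hb' : b⁻¹ ≠ ∞ := by simpa using (zero_lt_one.trans_le hb).ne'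
  rw [mixedSum_eq_mixedNorm ha hb]
  refine mixedBound A ENNReal.toReal_nonneg (ENNReal.toReal_mono hb' (by simpa using hab)) ?_
    (toReal_inv_add_toReal_inv_le ha hb (h.trans_eq ?_) (by norm_num))
  · exact ENNReal.toReal_le_of_le_ofReal zero_le_one (by simpa using hb)
  · rw [ENNReal.ofReal_div_of_pos (by norm_num)]
    simp

/-- The form `(x, y) ↦ x 0 * y 0`. -/
noncomputable def diagForm : NullSeqBilinForm :=
  (NullSeq.eval 0).smulRight (NullSeq.eval 0)

theorem diagForm_apply (x y : NullSeq) : diagForm x y = x 0 * y 0 := rfl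

theorem norm_diagForm_le : ‖diagForm‖ ≤ 1 := by
  rw [diagForm, ContinuousLinearMap.norm_smulRight_apply]
  have := NullSeq.norm_eval_le 0
  nlinarith [norm_nonneg (NullSeq.eval 0)]

theorem le_recipNorm {u : ℝ} (hu : 0 ≤ u) (x : ℕ → ℝ≥0∞) (i : ℕ) : x i ≤ recipNorm u x := by
  rcases hu.eq_or_lt with rfl | hu
  · rw [recipNorm_zero]
    exact le_iSup x i
  · rw [recipNorm_of_ne hu.ne']
    calc x i = (x i ^ u⁻¹) ^ u := by
          rw [← ENNReal.rpow_mul, inv_mul_cancel₀ hu.ne', ENNReal.rpow_one]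
      _ ≤ _ := by
          gcongr
          exact ENNReal.le_tsum i

/-- Tested on `diagForm`, which has norm at most 1 and an entry equal to 1. -/
theorem IsLittlewoodConstant.one_le {a b : ℝ≥0∞} {C : ℝ} (ha : 1 ≤ a) (hb : 1 ≤ b)
    (h : IsLittlewoodConstant a b C) : 1 ≤ C := by
  have h1 : (1 : ℝ≥0∞) ≤ mixedSum a b diagForm := by
    rw [mixedSum_eq_mixedNorm ha hb]
    refine le_trans ?_ (le_recipNorm ENNReal.toReal_nonneg _ 0)
    refine le_trans ?_ (le_recipNorm ENNReal.toReal_nonneg _ 0)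
    simp [absMatrix, diagForm_apply, NullSeq.e_apply]
  have h2 := h1.trans (h diagForm)
  rw [ENNReal.one_le_ofReal] at h2
  by_contra! hC
  rcases le_or_gt C 0 with h0 | h0
  · nlinarith [norm_nonneg diagForm]
  · nlinarith [norm_nonneg diagForm, norm_diagForm_le]

theorem isClosed_setOf_isLittlewoodConstant (a b : ℝ≥0∞) :
    IsClosed {C : ℝ | IsLittlewoodConstant a b C} := by
  simp only [IsLittlewoodConstant, Set.ofPred_forall]
  refine isClosed_iInter fun A => isClosed_le continuous_const ?_
  exact ENNReal.continuous_ofReal.comp (by fun_prop)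

/-- The given constant C shows that the set is nonempty; without it the real infimum would take the
default value 0. Closedness then gives attainment. -/
theorem isLeast_optimalConstant {a b : ℝ≥0∞} {C : ℝ} (ha : 1 ≤ a) (hb : 1 ≤ b)
    (h : IsLittlewoodConstant a b C) :
    IsLeast {C : ℝ | IsLittlewoodConstant a b C} (optimalConstant a b) := by
  have hbdd : BddBelow {C : ℝ | IsLittlewoodConstant a b C} := ⟨1, fun _ hC => hC.one_le ha hb⟩
  exact ⟨(isClosed_setOf_isLittlewoodConstant a b).csInf_mem ⟨C, h⟩ hbdd,
    fun _ hC => csInf_le hbdd hC⟩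

theorem exists_isLittlewoodConstant {a b : ℝ≥0∞} (ha : 1 ≤ a) (hb : 1 ≤ b)
    (h : a⁻¹ + b⁻¹ ≤ 3 / 2) : ∃ C : ℝ, IsLittlewoodConstant a b C := by
  rcases le_total b a with hab | hab
  · exact ⟨_, isLittlewoodConstant_of_le ha hb h hab⟩
  · exact ⟨_, (isLittlewoodConstant_of_le hb ha (by rwa [add_comm]) hab).swap hb ha hab⟩

theorem isLittlewoodConstant_one {a b : ℝ≥0∞} (ha : 1 ≤ a) (hb : 1 ≤ b)
    (h : a⁻¹ + b⁻¹ ≤ 1) : IsLittlewoodConstant a b 1 := by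
  have h32 : (1 : ℝ≥0∞) ≤ 3 / 2 := by
    rw [ENNReal.le_div_iff_mul_le (by simp) (by simp)]
    norm_num
  have key : ∀ {a b : ℝ≥0∞}, 1 ≤ a → 1 ≤ b → a⁻¹ + b⁻¹ ≤ 1 → b ≤ a →
      IsLittlewoodConstant a b 1 := fun {a b} ha hb h hab => by
    have h1 := toReal_inv_add_toReal_inv_le (c := 1) ha hb (by simpa using h) zero_le_one
    have h2 := isLittlewoodConstant_of_le ha hb (h.trans h32) hab
    rwa [max_eq_left (by linarith), Real.rpow_zero] at h2
  rcases le_total b a with hab | hab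
  · exact key ha hb h hab
  · exact (key hb ha (by rwa [add_comm]) hab).swap hb ha hab

theorem theorem3p3 :
    (∀ a b : ℝ≥0∞, 1 ≤ a → 1 ≤ b → a⁻¹ + b⁻¹ ≤ 3 / 2 →
      1 ≤ optimalConstant a b ∧
      IsLeast {C : ℝ | IsLittlewoodConstant a b C} (optimalConstant a b)) ∧
    (∀ a b : ℝ≥0∞, 1 ≤ a → 1 ≤ b → a⁻¹ + b⁻¹ ≤ 3 / 2 → b ≤ a →
      1 ≤ optimalConstant b a ∧
      optimalConstant b a ≤ optimalConstant a b ∧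
      optimalConstant a b ≤ (4 / Real.pi) ^ max 0 ((a⁻¹).toReal + (b⁻¹).toReal - 1)) ∧
    (∀ a b : ℝ≥0∞, 1 ≤ a → 1 ≤ b → a⁻¹ + b⁻¹ ≤ 1 → optimalConstant a b = 1) := by
  refine ⟨fun a b ha hb h => ?_, fun a b ha hb h hab => ?_, fun a b ha hb h => ?_⟩
  · obtain ⟨C, hC⟩ := exists_isLittlewoodConstant ha hb h
    have hl := isLeast_optimalConstant ha hb hC
    exact ⟨IsLittlewoodConstant.one_le ha hb hl.1, hl⟩
  · have hC := isLittlewoodConstant_of_le ha hb h hab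
    have hl := isLeast_optimalConstant ha hb hC
    have hl' := isLeast_optimalConstant hb ha (hC.swap ha hb hab)
    exact ⟨IsLittlewoodConstant.one_le hb ha hl'.1,
      hl'.2 (IsLittlewoodConstant.swap ha hb hab hl.1), hl.2 hC⟩
  · have hC := isLittlewoodConstant_one ha hb h
    have hl := isLeast_optimalConstant ha hb hC
    exact le_antisymm (hl.2 hC) (IsLittlewoodConstant.one_le ha hb hl.1)
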